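/- All rings are commutative with identity, and $\otimes$ means $\otimes_C$. Let $C$ be a ring, let $\lambda\in C$ be arbitrary, and let $A$ be a $C$-algebra of characteristic zero with structure map $\varphi:C\to A$; put $I_0=\ker\varphi$. Let $$Ш_C(A)=\bigoplus_{k\ge 0}A^{\otimes (k+1)}$$ be the shuffle Baxter algebra (the free Baxter $C$-algebra on $A$) of weight $\lambda$. Its multiplication is the $C$-bilinear mixed shuffle product determined by $$(x_0\otimes x_1\otimes\cdots\otimes x_m)\,(y_0\otimes y_1\otimes\cdots\otimes y_n)=\sum_{(\sigma,T)}\lambda^{|T|}\,x_0y_0\otimes\sigma(x^+\otimes y^+;T),\qquad m,n\ge 0.$$ Here $x^+=x_1\otimes\cdots\otimes x_m$, $y^+=y_1\otimes\cdots\otimes y_n$; $\sigma$ runs over the permutations of $\{1,\dots,m+n\}$ with $\sigma^{-1}(1)<\cdots<\sigma^{-1}(m)$ and $\sigma^{-1}(m+1)<\cdots<\sigma^{-1}(m+n)$; $T$ runs over the sets of pairs $(k,k+1)$, $1\le k<m+n$, with $\sigma(k)\le m<\sigma(k+1)$; and $\sigma(x^+\otimes y^+;T)\in A^{\otimes(m+n-|T|)}$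 is obtained from $u_{\sigma(1)}\otimes\cdots\otimes u_{\sigma(m+n)}$, where $(u_1,\dots,u_{m+n})=(x_1,\dots,x_m,y_1,\dots,y_n)$, by replacing, for each $(k,k+1)\in T$, the sign $\otimes$ between $u_{\sigma(k)}$ and $u_{\sigma(k+1)}$ by multiplication in $A$. Then the following statements are equivalent. 1. $Ш_C(A)$ is an integral domain. 2. $A$ is an integral domain and, for all $n\ge 1$, the $C/I_0$-module $A^{\otimes n}$ is torsion free, i.e. $$\{x\in A^{\otimes n}\mid \bar r x=0\text{ for some }\bar r\in C/I_0,\ \bar r\ne 0\}=\{0\}.$$ 3. $A$ is an integral domain and, for all $n\ge 1$, the natural map $A^{\otimes n}\to \mathrm{Fr}(C/I_0)\otimes A^{\otimes n}$, $x\mapsto 1\otimes x$, is injective, where $\mathrm{Fr}(C/I_0)$ is the field of fractions of the domain $C/I_0$. -/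

import Mathlib

open scoped TensorProduct DirectSum

namespace ShuffleBaxter

/-- An `(m, n)`-mixable shuffle `(σ, T)`, with indices starting at `0`: `σ` is a permutation of the
`m + n` letters such that `σ⁻¹` is increasing on the first `m` and on the last `n` letters, and `T`
is a set of admissible pairs `(k, k + 1)`, i.e. of pairs with `σ k < m ≤ σ (k + 1)`; such a pair is
recorded by its first member `k`. -/
@[ext]
structure MixableShuffle (m n : ℕ) where
  σ : Equiv.Perm (Fin (m + n))
  left_mono : StrictMono fun i : Fin m => σ.symm (Fin.castAdd n i)
  right_mono : StrictMono fun j : Fin n => σ.symm (Fin.natAdd m j)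
  T : Finset (Fin (m + n))
  admissible : ∀ k ∈ T, ∃ h : (k : ℕ) + 1 < m + n,
    (σ k : ℕ) < m ∧ m ≤ (σ ⟨(k : ℕ) + 1, h⟩ : ℕ)

theorem finite_mixableShuffle (m n : ℕ) : Finite (MixableShuffle m n) :=
  Finite.of_injective (fun s : MixableShuffle m n => (s.σ, s.T)) fun s t h => by
    simp only [Prod.mk.injEq] at h
    exact MixableShuffle.ext h.1 h.2

noncomputable instance (m n : ℕ) : Fintype (MixableShuffle m n) :=
  @Fintype.ofFinite _ (finite_mixableShuffle m n)

namespace MixableShuffle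

variable {m n : ℕ} (s : MixableShuffle m n)

theorem card_lt_le (k : Fin (m + n)) : (s.T.filter (· < k)).card ≤ (k : ℕ) := by
  calc (s.T.filter (· < k)).card ≤ (Finset.Iio k).card :=
        Finset.card_le_card fun t ht => by simpa using (Finset.mem_filter.1 ht).2
    _ = k := by simp

theorem sub_card_lt (k : Fin (m + n)) :
    (k : ℕ) - (s.T.filter (· < k)).card < m + n - s.T.card := by
  have h1 := s.card_lt_le k
  have h2 : (s.T.filter (¬ · < k)).card < m + n - k := by
    have : (s.T.filter (¬ · < k)).card ≤ (Finset.Ico (k : ℕ) (m + n - 1)).card := by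
      rw [← Finset.card_map Fin.valEmbedding]
      refine Finset.card_le_card fun t ht => ?_
      simp only [Finset.mem_map, Finset.mem_filter, Fin.valEmbedding_apply] at ht
      obtain ⟨t', ⟨ht, hk⟩, rfl⟩ := ht
      obtain ⟨h, -⟩ := s.admissible _ ht
      rw [not_lt, Fin.le_def] at hk
      rw [Finset.mem_Ico]
      omega
    rw [Nat.card_Ico] at this
    have := k.2
    omega
  have h3 := Finset.card_filter_add_card_filter_not (s := s.T) (· < k)
  have := k.2
  omega

/-- The tensor slot of the `k`-th entry of the shuffled word after the entries of each pair in `T`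
have been multiplied together: every pair in `T` to the left of `k` moves it one slot to the
left. -/
def block (k : Fin (m + n)) : Fin (m + n - s.T.card) :=
  ⟨(k : ℕ) - (s.T.filter (· < k)).card, s.sub_card_lt k⟩

/-- The tensor slot into which each of the factors of `x₀ ⊗ x₁ ⊗ ⋯ ⊗ xₘ` (left) and
`y₀ ⊗ y₁ ⊗ ⋯ ⊗ yₙ` (right) is multiplied in the term `x₀y₀ ⊗ σ(x⁺ ⊗ y⁺; T)`. -/
def slot : Fin (m + 1) ⊕ Fin (n + 1) → Fin (m + n - s.T.card + 1) :=
  Sum.elim (Fin.cases 0 fun i => (s.block (s.σ.symm (Fin.castAdd n i))).succ)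
    (Fin.cases 0 fun j => (s.block (s.σ.symm (Fin.natAdd m j))).succ)

end MixableShuffle

section Collapse

variable (C : Type*) {A : Type*} [CommRing C] [CommRing A] [Algebra C A]

/-- The multilinear map `(xᵢ)ᵢ ↦ ⨂ⱼ ∏_{f i = j} xᵢ`. -/
noncomputable def collapse {ι κ : Type*} [Fintype ι] [Fintype κ] [DecidableEq κ] (f : ι → κ) :
    MultilinearMap C (fun _ : ι => A) (⨂[C] _ : κ, A) where
  toFun x := PiTensorProduct.tprod C fun j => ∏ i with f i = j, x i
  map_update_add' := by
    classical
    intro inst x i a b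
    obtain rfl : inst = Classical.decEq ι := Subsingleton.elim _ _
    have key : ∀ c : A, (fun j => ∏ i' with f i' = j, Function.update x i c i') =
        Function.update (fun j => ∏ i' with f i' = j, x i') (f i)
          (c * ∏ i' ∈ (Finset.univ.filter (f · = f i)) \ {i}, x i') := by
      intro c
      funext j
      by_cases h : j = f i
      · subst h
        rw [Function.update_self, Finset.prod_update_of_mem (by simp)]
      · rw [Function.update_of_ne h, Finset.prod_update_of_notMem]
        simpa using fun h' => h h'.symm
    simp only [key, add_mul, MultilinearMap.map_update_add]
  map_update_smul' := by
    classical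
    intro inst x i c a
    obtain rfl : inst = Classical.decEq ι := Subsingleton.elim _ _
    have key : ∀ c : A, (fun j => ∏ i' with f i' = j, Function.update x i c i') =
        Function.update (fun j => ∏ i' with f i' = j, x i') (f i)
          (c * ∏ i' ∈ (Finset.univ.filter (f · = f i)) \ {i}, x i') := by
      intro c
      funext j
      by_cases h : j = f i
      · subst h
        rw [Function.update_self, Finset.prod_update_of_mem (by simp)]
      · rw [Function.update_of_ne h, Finset.prod_update_of_notMem]
        simpa using fun h' => h h'.symm
    simp only [key, smul_mul_assoc, MultilinearMap.map_update_smul]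

end Collapse

end ShuffleBaxter

/-- The underlying `C`-module `⨁_{k ≥ 0} A^{⊗(k+1)}` of the shuffle Baxter `C`-algebra on `A` of
weight `wt`. -/
def ShuffleBaxterAlgebra (C A : Type*) [CommRing C] [CommRing A] [Algebra C A] (_wt : C) : Type _ :=
  ⨁ k : ℕ, ⨂[C]^(k + 1) A

namespace ShuffleBaxterAlgebra

open ShuffleBaxter

variable {C A : Type*} [CommRing C] [CommRing A] [Algebra C A] {wt : C}

noncomputable instance : AddCommGroup (ShuffleBaxterAlgebra C A wt) :=
  inferInstanceAs (AddCommGroup (⨁ k : ℕ, ⨂[C]^(k + 1) A))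

noncomputable instance : Module C (ShuffleBaxterAlgebra C A wt) :=
  inferInstanceAs (Module C (⨁ k : ℕ, ⨂[C]^(k + 1) A))

variable (wt) in
/-- The inclusion of the summand `A^{⊗(k+1)}`. -/
noncomputable def incl (k : ℕ) : (⨂[C]^(k + 1) A) →ₗ[C] ShuffleBaxterAlgebra C A wt :=
  DirectSum.lof C ℕ (fun k => ⨂[C]^(k + 1) A) k

/-- A family of linear maps on the summands gives a linear map on the direct sum. -/
noncomputable def lift {N : Type*} [AddCommGroup N] [Module C N]
    (f : ∀ k : ℕ, (⨂[C]^(k + 1) A) →ₗ[C] N) : ShuffleBaxterAlgebra C A wt →ₗ[C] N :=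
  DirectSum.toModule C ℕ N f

theorem lift_incl {N : Type*} [AddCommGroup N] [Module C N]
    (f : ∀ k : ℕ, (⨂[C]^(k + 1) A) →ₗ[C] N) (k : ℕ) (x : ⨂[C]^(k + 1) A) :
    lift f (incl wt k x) = f k x :=
  DirectSum.toModule_lof (M := fun k : ℕ => ⨂[C]^(k + 1) A) (φ := f) C k x

variable (C A wt) in
/-- The mixed shuffle product `A^{⊗(m+1)} × A^{⊗(n+1)} → ⨁ₖ A^{⊗(k+1)}`; see `mulTensor_tprod` for
its value on pure tensors. -/
noncomputable def mulTensor (m n : ℕ) :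
    (⨂[C]^(m + 1) A) →ₗ[C] (⨂[C]^(n + 1) A) →ₗ[C] ShuffleBaxterAlgebra C A wt :=
  (TensorProduct.mk C (⨂[C]^(m + 1) A) (⨂[C]^(n + 1) A)).compr₂
    (∑ s : MixableShuffle m n, wt ^ s.T.card •
      (incl wt (m + n - s.T.card) ∘ₗ PiTensorProduct.lift (collapse C s.slot) ∘ₗ
        (PiTensorProduct.tmulEquiv C A).toLinearMap))

variable (C A wt) in
/-- The mixed shuffle product as a bilinear map. -/
noncomputable def mulLinear : ShuffleBaxterAlgebra C A wt →ₗ[C] ShuffleBaxterAlgebra C A wt →ₗ[C]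
    ShuffleBaxterAlgebra C A wt :=
  lift fun m => (lift fun n => (mulTensor C A wt m n).flip).flip

noncomputable instance : Mul (ShuffleBaxterAlgebra C A wt) := ⟨fun x y => mulLinear C A wt x y⟩

/-- The unit is the unit of `A`, in the summand `A^{⊗1}`. -/
noncomputable instance : One (ShuffleBaxterAlgebra C A wt) :=
  ⟨incl wt 0 (PiTensorProduct.tprod C fun _ => 1)⟩

theorem mul_def (x y : ShuffleBaxterAlgebra C A wt) : x * y = mulLinear C A wt x y := rfl

theorem incl_mul_incl (m n : ℕ) (x : ⨂[C]^(m + 1) A) (y : ⨂[C]^(n + 1) A) :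
    incl wt m x * incl wt n y = mulTensor C A wt m n x y := by
  rw [mul_def, mulLinear, lift_incl, LinearMap.flip_apply, lift_incl, LinearMap.flip_apply]

theorem incl_tprod_mul (m n : ℕ) (x : Fin (m + 1) → A) (y : Fin (n + 1) → A) :
    incl wt m (PiTensorProduct.tprod C x) * incl wt n (PiTensorProduct.tprod C y) =
      ∑ s : MixableShuffle m n, wt ^ s.T.card •
        incl wt (m + n - s.T.card) (collapse C s.slot (Sum.elim x y)) := by
  rw [incl_mul_incl, mulTensor]
  simp only [LinearMap.compr₂_apply, TensorProduct.mk_apply, LinearMap.sum_apply,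
    LinearMap.smul_apply, LinearMap.comp_apply, LinearEquiv.coe_coe]
  refine Finset.sum_congr rfl fun s _ => ?_
  rw [PiTensorProduct.tmulEquiv_apply, PiTensorProduct.lift.tprod]

/-- The defining formula of the mixed shuffle product: the product of `x₀ ⊗ x⁺` and `y₀ ⊗ y⁺` is
`∑_{(σ, T)} wt^|T| x₀y₀ ⊗ σ(x⁺ ⊗ y⁺; T)`. Here `u = (x₁, …, xₘ, y₁, …, yₙ)`, and
`σ(x⁺ ⊗ y⁺; T)` is `u_{σ(1)} ⊗ ⋯ ⊗ u_{σ(m+n)}` with `⊗` replaced by the product of `A` at the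
pairs in `T`. -/
theorem mulTensor_tprod (m n : ℕ) (x₀ y₀ : A) (x : Fin m → A) (y : Fin n → A) :
    mulTensor C A wt m n (PiTensorProduct.tprod C (Fin.cons x₀ x : Fin (m + 1) → A))
        (PiTensorProduct.tprod C (Fin.cons y₀ y : Fin (n + 1) → A)) =
      ∑ s : MixableShuffle m n, wt ^ s.T.card • incl wt (m + n - s.T.card)
        (PiTensorProduct.tprod C (Fin.cons (x₀ * y₀)
          (fun j => ∏ k with s.block k = j, (Fin.append x y : Fin (m + n) → A) (s.σ k)) :
            Fin (m + n - s.T.card + 1) → A)) := by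
  rw [← incl_mul_incl, incl_tprod_mul]
  refine Finset.sum_congr rfl fun s _ => ?_
  congr 2
  change PiTensorProduct.tprod C _ = _
  congr 1
  funext j
  rw [Finset.prod_filter, Fintype.prod_sum_type, Fin.prod_univ_succ, Fin.prod_univ_succ]
  refine Fin.cases ?_ (fun j => ?_) j
  · simp [MixableShuffle.slot, Fin.succ_ne_zero]
  · rw [Fin.cons_succ, Finset.prod_filter, ← Equiv.prod_comp s.σ.symm, Fin.prod_univ_add]
    simp [MixableShuffle.slot, (Fin.succ_ne_zero _).symm]

theorem hom_ext {N : Type*} [AddCommGroup N] [Module C N]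
    {f g : ShuffleBaxterAlgebra C A wt →ₗ[C] N}
    (h : ∀ (k : ℕ) (x : Fin (k + 1) → A), f (incl wt k (PiTensorProduct.tprod C x)) =
      g (incl wt k (PiTensorProduct.tprod C x))) : f = g := by
  refine DirectSum.linearMap_ext (M := fun k : ℕ => ⨂[C]^(k + 1) A) C fun k => ?_
  exact PiTensorProduct.ext (MultilinearMap.ext fun x => h k x)

end ShuffleBaxterAlgebra

namespace ShuffleBaxter

theorem sigma_ext {ι : Type*} {p q : Σ k : ℕ, ι → Fin (k + 1)} (h₁ : p.1 = q.1)
    (h₂ : ∀ i, (p.2 i : ℕ) = (q.2 i : ℕ)) : p = q := by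
  obtain ⟨k, f⟩ := p
  obtain ⟨l, g⟩ := q
  obtain rfl : k = l := h₁
  obtain rfl : f = g := funext fun i => Fin.ext (h₂ i)
  rfl

/-- Slot maps of the terms of a product of two tensors. -/
structure IsQuasiShuffle (m n : ℕ) (p : Σ k : ℕ, Fin (m + 1) ⊕ Fin (n + 1) → Fin (k + 1)) :
    Prop where
  inl_zero : p.2 (Sum.inl 0) = 0
  inr_zero : p.2 (Sum.inr 0) = 0
  inl_mono : StrictMono fun i => p.2 (Sum.inl i)
  inr_mono : StrictMono fun i => p.2 (Sum.inr i)
  surj : Function.Surjective p.2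

namespace MixableShuffle

variable {m n : ℕ} (s : MixableShuffle m n)

theorem card_lt_add (a b : Fin (m + n)) (h : a < b) : (s.T.filter (· < b)).card =
    (s.T.filter (· < a)).card + ((Finset.Ico a b).filter (· ∈ s.T)).card := by
  rw [← Finset.card_union_of_disjoint]
  · congr 1
    ext t
    simp only [Finset.mem_filter, Finset.mem_union, Finset.mem_Ico]
    constructor
    · rintro ⟨ht, hb⟩
      by_cases ha : t < a
      · exact Or.inl ⟨ht, ha⟩
      · exact Or.inr ⟨⟨not_lt.1 ha, hb⟩, ht⟩
    · rintro (⟨ht, ha⟩ | ⟨⟨_, hb⟩, ht⟩)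
      · exact ⟨ht, ha.trans h⟩
      · exact ⟨ht, hb⟩
  · rw [Finset.disjoint_left]
    intro t ht ht'
    simp only [Finset.mem_filter, Finset.mem_Ico] at ht ht'
    exact absurd ht.2 (not_lt.2 ht'.1.1)

theorem block_le {a b : Fin (m + n)} (h : a ≤ b) : s.block a ≤ s.block b := by
  rcases h.eq_or_lt with rfl | h
  · rfl
  have h1 := s.card_lt_add a b h
  have h2 : ((Finset.Ico a b).filter (· ∈ s.T)).card ≤ b - a := by
    refine (Finset.card_filter_le _ _).trans ?_
    simp
  have := s.card_lt_le a
  rw [Fin.le_def]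
  simp only [block]
  rw [Fin.lt_def] at h
  omega

theorem block_lt_of_notMem {a b t : Fin (m + n)} (ha : a ≤ t) (hb : t < b) (ht : t ∉ s.T) :
    s.block a < s.block b := by
  have h := ha.trans_lt hb
  have h1 := s.card_lt_add a b h
  have h2 : ((Finset.Ico a b).filter (· ∈ s.T)).card < b - a := by
    rw [← Fin.card_Ico]
    refine Finset.card_lt_card (Finset.filter_ssubset.2 ⟨t, Finset.mem_Ico.2 ⟨ha, hb⟩, ht⟩)
  have := s.card_lt_le a
  rw [Fin.lt_def]
  simp only [block]
  rw [Fin.lt_def] at h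
  omega

theorem block_lt_or {a b : Fin (m + n)} (h : a < b) :
    s.block a < s.block b ∨ ((b : ℕ) = a + 1 ∧ a ∈ s.T) := by
  by_cases ha : a ∈ s.T
  · by_cases hb : (b : ℕ) = a + 1
    · exact Or.inr ⟨hb, ha⟩
    · obtain ⟨h1, h2, h3⟩ := s.admissible a ha
      left
      rw [Fin.lt_def] at h
      refine s.block_lt_of_notMem (t := ⟨a + 1, h1⟩) (by simp [Fin.le_def])
        (by rw [Fin.lt_def]; simp only; omega) fun h4 => ?_
      obtain ⟨_, h5, _⟩ := s.admissible _ h4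
      omega
  · exact Or.inl (s.block_lt_of_notMem le_rfl h ha)

theorem block_succ_mem {a : Fin (m + n)} (h : (a : ℕ) + 1 < m + n) (ha : a ∈ s.T) :
    (s.block ⟨a + 1, h⟩ : ℕ) = s.block a := by
  have h1 := s.card_lt_add a ⟨a + 1, h⟩ (by simp [Fin.lt_def])
  have h2 : ((Finset.Ico a ⟨a + 1, h⟩).filter (· ∈ s.T)).card = 1 := by
    rw [Finset.filter_true_of_mem, Fin.card_Ico]
    · simp
    · intro t ht
      rw [Finset.mem_Ico, Fin.le_def, Fin.lt_def] at ht
      have : t = a := Fin.ext (by simp only at ht; omega)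
      rwa [this]
  have := s.card_lt_le a
  simp only [block]
  omega

theorem block_succ_notMem {a : Fin (m + n)} (h : (a : ℕ) + 1 < m + n) (ha : a ∉ s.T) :
    (s.block ⟨a + 1, h⟩ : ℕ) = s.block a + 1 := by
  have h1 := s.card_lt_add a ⟨a + 1, h⟩ (by simp [Fin.lt_def])
  have h2 : ((Finset.Ico a ⟨a + 1, h⟩).filter (· ∈ s.T)).card = 0 := by
    rw [Finset.filter_false_of_mem, Finset.card_empty]
    · intro t ht
      rw [Finset.mem_Ico, Fin.le_def, Fin.lt_def] at ht
      have : t = a := Fin.ext (by simp only at ht; omega)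
      rwa [this]
  have := s.card_lt_le a
  simp only [block]
  omega

theorem block_surjective : Function.Surjective s.block := by
  have hinj : Function.Injective fun k : {k // k ∉ s.T} => s.block k := by
    rintro ⟨a, ha⟩ ⟨b, hb⟩ hab
    rw [Subtype.mk.injEq]
    rcases lt_trichotomy a b with h | h | h
    · exact absurd hab (s.block_lt_of_notMem le_rfl h ha).ne
    · exact h
    · exact absurd hab (s.block_lt_of_notMem le_rfl h hb).ne'
  have hb := (Fintype.bijective_iff_injective_and_card _).2 ⟨hinj, by
    rw [Fintype.card_subtype_compl]; simp⟩
  intro j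
  obtain ⟨k, hk⟩ := hb.2 j
  exact ⟨k, hk⟩

theorem isQuasiShuffle : IsQuasiShuffle m n ⟨m + n - s.T.card, s.slot⟩ where
  inl_zero := rfl
  inr_zero := rfl
  inl_mono := by
    refine Fin.strictMono_iff_lt_succ.2 fun i => ?_
    cases m with
    | zero => exact i.elim0
    | succ m =>
      refine Fin.cases ?_ (fun i => ?_) i
      · exact Fin.succ_pos (s.block (s.σ.symm (Fin.castAdd n (0 : Fin (m + 1)))))
      · have h : s.σ.symm (Fin.castAdd n i.castSucc) < s.σ.symm (Fin.castAdd n i.succ) :=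
          s.left_mono Fin.castSucc_lt_succ
        rcases s.block_lt_or h with h' | ⟨h1, h2⟩
        · simpa [slot, ← Fin.succ_castSucc] using h'
        · obtain ⟨h3, -, h4⟩ := s.admissible _ h2
          have : (⟨(s.σ.symm (Fin.castAdd n i.castSucc) : ℕ) + 1, h3⟩ : Fin _) =
            s.σ.symm (Fin.castAdd n i.succ) := Fin.ext h1.symm
          rw [this, Equiv.apply_symm_apply] at h4
          have := i.2
          simp at h4
          omega
  inr_mono := by
    refine Fin.strictMono_iff_lt_succ.2 fun i => ?_
    cases n with
    | zero => exact i.elim0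
    | succ n =>
      refine Fin.cases ?_ (fun i => ?_) i
      · exact Fin.succ_pos (s.block (s.σ.symm (Fin.natAdd m (0 : Fin (n + 1)))))
      · have h : s.σ.symm (Fin.natAdd m i.castSucc) < s.σ.symm (Fin.natAdd m i.succ) :=
          s.right_mono Fin.castSucc_lt_succ
        rcases s.block_lt_or h with h' | ⟨h1, h2⟩
        · simpa [slot, ← Fin.succ_castSucc] using h'
        · obtain ⟨h3, h4, -⟩ := s.admissible _ h2
          rw [Equiv.apply_symm_apply] at h4
          simp at h4
  surj := by
    intro j
    refine Fin.cases ⟨Sum.inl 0, rfl⟩ (fun j => ?_) j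
    obtain ⟨k, rfl⟩ := s.block_surjective j
    obtain ⟨l, rfl⟩ := s.σ.symm.surjective k
    refine Fin.addCases (fun i => ⟨Sum.inl i.succ, ?_⟩) (fun i => ⟨Sum.inr i.succ, ?_⟩) l
    · simp [slot]
    · simp [slot]

theorem eq_sort : s.σ = Tuple.sort fun l => (s.block (s.σ.symm l) : ℕ) := by
  rw [Tuple.eq_sort_iff]
  constructor
  · intro a b h
    simpa using s.block_le h
  · intro a b h hab
    simp only [Equiv.symm_apply_apply] at hab
    rcases s.block_lt_or h with h' | ⟨h1, h2⟩
    · exact absurd (Fin.ext hab) h'.ne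
    · obtain ⟨h3, h4, h5⟩ := s.admissible _ h2
      have : (⟨(a : ℕ) + 1, h3⟩ : Fin _) = b := Fin.ext h1.symm
      rw [this] at h5
      rw [Fin.lt_def]
      omega

variable (m n) in
/-- A mixable shuffle gives a slot map. -/
def toQuasiShuffle (s : MixableShuffle m n) : {p // IsQuasiShuffle m n p} :=
  ⟨⟨m + n - s.T.card, s.slot⟩, s.isQuasiShuffle⟩

theorem toQuasiShuffle_injective : Function.Injective (toQuasiShuffle m n) := by
  intro s t h
  have h0 := congrArg Subtype.val h
  have key : ∀ l, (s.block (s.σ.symm l) : ℕ) = t.block (t.σ.symm l) := by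
    have hv : ∀ i, (s.slot i : ℕ) = t.slot i := fun i =>
      congrArg (fun p : Σ k : ℕ, Fin (m + 1) ⊕ Fin (n + 1) → Fin (k + 1) => (p.2 i : ℕ)) h0
    intro l
    refine Fin.addCases (fun i => ?_) (fun i => ?_) l
    · simpa [slot] using hv (Sum.inl i.succ)
    · simpa [slot] using hv (Sum.inr i.succ)
  have hσ : s.σ = t.σ := by
    rw [s.eq_sort, t.eq_sort]
    congr 1
    exact funext key
  have key2 : ∀ k, (s.block k : ℕ) = t.block k := by
    intro k
    have := key (s.σ k)
    rwa [Equiv.symm_apply_apply, hσ, Equiv.symm_apply_apply] at this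
  refine MixableShuffle.ext hσ ?_
  have aux : ∀ s t : MixableShuffle m n, (∀ k, (s.block k : ℕ) = t.block k) → s.T ⊆ t.T := by
    intro s t hst k hk
    by_contra hk'
    obtain ⟨h1, -⟩ := s.admissible k hk
    have h2 := s.block_succ_mem h1 hk
    have h3 := t.block_succ_notMem h1 hk'
    rw [hst, hst] at h2
    omega
  exact Finset.Subset.antisymm (aux s t key2) (aux t s fun k => (key2 k).symm)

theorem toQuasiShuffle_surjective : Function.Surjective (toQuasiShuffle m n) := by
  classical
  rintro ⟨⟨k, H⟩, hz, hz', hl, hr, hs⟩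
  dsimp only at hz hz' hl hr hs
  let h : Fin (m + n) → ℕ := Fin.addCases (fun i => (H (Sum.inl i.succ) : ℕ) - 1)
    (fun j => (H (Sum.inr j.succ) : ℕ) - 1)
  have hlpos : ∀ i : Fin m, 0 < (H (Sum.inl i.succ) : ℕ) := fun i => by
    have := hl (Fin.succ_pos i)
    simp only [hz, Fin.lt_def] at this
    simpa using this
  have hrpos : ∀ i : Fin n, 0 < (H (Sum.inr i.succ) : ℕ) := fun i => by
    have := hr (Fin.succ_pos i)
    simp only [hz', Fin.lt_def] at this
    simpa using this
  have hhl : ∀ i, h (Fin.castAdd n i) = (H (Sum.inl i.succ) : ℕ) - 1 := fun i => by simp [h]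
  have hhr : ∀ i, h (Fin.natAdd m i) = (H (Sum.inr i.succ) : ℕ) - 1 := fun i => by simp [h]
  have hlt : ∀ l, h l < k := by
    intro l
    refine Fin.addCases (fun i => ?_) (fun i => ?_) l
    · rw [hhl]
      have := hlpos i
      have := (H (Sum.inl i.succ)).2
      omega
    · rw [hhr]
      have := hrpos i
      have := (H (Sum.inr i.succ)).2
      omega
  have hsurj : ∀ j < k, ∃ l, h l = j := by
    intro j hj
    obtain ⟨x, hx⟩ := hs ⟨j + 1, by omega⟩
    rcases x with x | x
    · revert hx
      refine Fin.cases (fun hx => ?_) (fun i hx => ⟨Fin.castAdd n i, ?_⟩) x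
      · rw [hz] at hx
        simp [Fin.ext_iff] at hx
      · rw [hhl, hx]
        simp
    · revert hx
      refine Fin.cases (fun hx => ?_) (fun i hx => ⟨Fin.natAdd m i, ?_⟩) x
      · rw [hz'] at hx
        simp [Fin.ext_iff] at hx
      · rw [hhr, hx]
        simp
  have hhl' : ∀ i j, i < j → h (Fin.castAdd n i) < h (Fin.castAdd n j) := by
    intro i j hij
    have := hl (Fin.succ_lt_succ_iff.2 hij)
    rw [hhl, hhl]
    rw [Fin.lt_def] at this
    have := hlpos i
    simp only at *
    omega
  have hhr' : ∀ i j, i < j → h (Fin.natAdd m i) < h (Fin.natAdd m j) := by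
    intro i j hij
    have := hr (Fin.succ_lt_succ_iff.2 hij)
    rw [hhr, hhr]
    rw [Fin.lt_def] at this
    have := hrpos i
    simp only at *
    omega
  let σ := Tuple.sort h
  obtain ⟨hσ₁, hσ₂⟩ := (Tuple.eq_sort_iff (f := h) (σ := σ)).1 rfl
  have hσ₃ : ∀ a b, h a < h b → σ.symm a < σ.symm b := by
    intro a b hab
    by_contra hc
    have := hσ₁ (not_lt.1 hc)
    simp only [Function.comp, Equiv.apply_symm_apply] at this
    omega
  let s : MixableShuffle m n :=
    { σ := σ
      left_mono := fun i j hij => hσ₃ _ _ (hhl' i j hij)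
      right_mono := fun i j hij => hσ₃ _ _ (hhr' i j hij)
      T := Finset.univ.filter fun k => ∃ h' : (k : ℕ) + 1 < m + n, h (σ k) = h (σ ⟨k + 1, h'⟩)
      admissible := by
        intro a ha
        obtain ⟨h1, h2⟩ := (Finset.mem_filter.1 ha).2
        refine ⟨h1, ?_⟩
        have h3 := hσ₂ a ⟨a + 1, h1⟩ (by simp [Fin.lt_def]) h2
        revert h2 h3
        generalize σ a = u
        generalize σ ⟨a + 1, h1⟩ = v
        refine Fin.addCases (fun i => ?_) (fun i => ?_) u <;>
          refine Fin.addCases (fun j => ?_) (fun j => ?_) v <;> intro h2 h3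
        · exact absurd h2 (hhl' i j (by
            rw [Fin.lt_def] at h3 ⊢
            simp only [Fin.val_castAdd] at h3
            omega)).ne
        · simp
        · rw [Fin.lt_def] at h3
          simp at h3
          have := j.2
          omega
        · exact absurd h2 (hhr' i j (by
            rw [Fin.lt_def] at h3 ⊢
            simp only [Fin.val_natAdd] at h3
            omega)).ne }
  have hblock : ∀ (a : ℕ) (ha : a < m + n), (s.block ⟨a, ha⟩ : ℕ) = h (σ ⟨a, ha⟩) := by
    intro a
    induction a with
    | zero =>
      intro ha
      have h1 : (s.block ⟨0, ha⟩ : ℕ) = 0 := by simp [block]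
      rw [h1]
      obtain ⟨l, hl0⟩ := hsurj 0 ((Nat.zero_le _).trans_lt (hlt ⟨0, ha⟩))
      have := hσ₁ (show (⟨0, ha⟩ : Fin (m + n)) ≤ σ.symm l by simp [Fin.le_def])
      simp only [Function.comp, Equiv.apply_symm_apply] at this
      omega
    | succ a ih =>
      intro ha
      have ih := ih (by omega)
      have hle := hσ₁ (show (⟨a, by omega⟩ : Fin (m + n)) ≤ ⟨a + 1, ha⟩ by simp [Fin.le_def])
      simp only [Function.comp] at hle
      by_cases hT : (⟨a, by omega⟩ : Fin (m + n)) ∈ s.T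
      · rw [s.block_succ_mem ha hT, ih]
        obtain ⟨h1, h2⟩ := (Finset.mem_filter.1 hT).2
        exact h2
      · rw [s.block_succ_notMem ha hT, ih]
        have hne : h (σ ⟨a, by omega⟩) ≠ h (σ ⟨a + 1, ha⟩) := fun h' =>
          hT (Finset.mem_filter.2 ⟨Finset.mem_univ _, ha, h'⟩)
        by_contra hc
        obtain ⟨l, hl'⟩ := hsurj (h (σ ⟨a, by omega⟩) + 1) (by
          have := hlt (σ ⟨a + 1, ha⟩)
          omega)
        rcases le_or_gt (σ.symm l) ⟨a, by omega⟩ with h' | h'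
        · have := hσ₁ h'
          simp only [Function.comp, Equiv.apply_symm_apply] at this
          omega
        · have := hσ₁ (show (⟨a + 1, ha⟩ : Fin (m + n)) ≤ σ.symm l from h')
          simp only [Function.comp, Equiv.apply_symm_apply] at this
          omega
  have hk : m + n - s.T.card = k := by
    rcases lt_trichotomy (m + n - s.T.card) k with h' | h' | h'
    · obtain ⟨l, hl'⟩ := hsurj _ h'
      have := hblock (σ.symm l) (σ.symm l).2
      simp only [Fin.eta, Equiv.apply_symm_apply] at this
      have := (s.block (σ.symm l)).2
      omega
    · exact h'
    · obtain ⟨a, ha⟩ := s.block_surjective ⟨k, h'⟩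
      have h1 := hblock a a.2
      simp only [Fin.eta, ha] at h1
      have := hlt (σ a)
      omega
  refine ⟨s, Subtype.ext (sigma_ext hk ?_)⟩
  rintro (i | i)
  · refine Fin.cases ?_ (fun i => ?_) i
    · change (0 : ℕ) = H (Sum.inl 0)
      rw [hz]; rfl
    · have h1 := hblock (σ.symm (Fin.castAdd n i)) (Fin.is_lt _)
      simp only [Fin.eta, Equiv.apply_symm_apply] at h1
      change (s.block (σ.symm (Fin.castAdd n i)) : ℕ) + 1 = H (Sum.inl i.succ)
      rw [h1, hhl]
      have := hlpos i
      omega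
  · refine Fin.cases ?_ (fun i => ?_) i
    · change (0 : ℕ) = H (Sum.inr 0)
      rw [hz']; rfl
    · have h1 := hblock (σ.symm (Fin.natAdd m i)) (Fin.is_lt _)
      simp only [Fin.eta, Equiv.apply_symm_apply] at h1
      change (s.block (σ.symm (Fin.natAdd m i)) : ℕ) + 1 = H (Sum.inr i.succ)
      rw [h1, hhr]
      have := hrpos i
      omega

/-- Mixable shuffles are the same as their slot maps. -/
noncomputable def equivQuasiShuffle (m n : ℕ) :
    MixableShuffle m n ≃ {p // IsQuasiShuffle m n p} :=
  Equiv.ofBijective (toQuasiShuffle m n) ⟨toQuasiShuffle_injective, toQuasiShuffle_surjective⟩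

end MixableShuffle

noncomputable instance (m n : ℕ) : Fintype {p // IsQuasiShuffle m n p} :=
  Fintype.ofEquiv _ (MixableShuffle.equivQuasiShuffle m n)

end ShuffleBaxter

namespace ShuffleBaxter

theorem factor_unique {ι : Type*} {k k' l : ℕ} {H : ι → Fin (k + 1)} {H' : ι → Fin (k' + 1)}
    {g : Fin (k + 1) → Fin (l + 1)} {g' : Fin (k' + 1) → Fin (l + 1)}
    (hH : Function.Surjective H) (hH' : Function.Surjective H') (hg : StrictMono g)
    (hg' : StrictMono g') (h : ∀ i, g (H i) = g' (H' i)) :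
    k = k' ∧ (∀ i, (H i : ℕ) = H' i) ∧
      ∀ j (h₁ : j < k + 1) (h₂ : j < k' + 1), g ⟨j, h₁⟩ = g' ⟨j, h₂⟩ := by
  have hr : Set.range g = Set.range g' := by
    rw [← hH.range_comp, ← hH'.range_comp]
    congr 1
    exact funext h
  have hk : k = k' := by
    have h1 := Set.ncard_range_of_injective hg.injective
    have h2 := Set.ncard_range_of_injective hg'.injective
    rw [hr, h2] at h1
    simpa using h1.symm
  subst hk
  obtain rfl : g = g' := (hg.range_inj hg').1 hr
  exact ⟨rfl, fun i => congrArg _ (hg.injective (h i)), fun _ _ _ => rfl⟩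

theorem factor_exists {ι : Type*} [Fintype ι] [Nonempty ι] {l : ℕ} (f : ι → Fin (l + 1)) :
    ∃ (k : ℕ) (H : ι → Fin (k + 1)) (g : Fin (k + 1) → Fin (l + 1)),
      Function.Surjective H ∧ StrictMono g ∧ ∀ i, g (H i) = f i := by
  classical
  have hc : (Finset.univ.image f).card = (Finset.univ.image f).card - 1 + 1 := by
    have : 0 < (Finset.univ.image f).card := Finset.card_pos.2 (Finset.univ_nonempty.image f)
    omega
  let e := (Finset.univ.image f).orderIsoOfFin hc
  refine ⟨_, fun i => e.symm ⟨f i, Finset.mem_image_of_mem _ (Finset.mem_univ i)⟩,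
    fun j => (e j : Fin (l + 1)), ?_, fun a b hab => e.strictMono hab, fun i => ?_⟩
  · intro j
    obtain ⟨i, -, hi⟩ := Finset.mem_image.1 (e j).2
    refine ⟨i, ?_⟩
    rw [OrderIso.symm_apply_eq]
    exact Subtype.ext hi
  · simp

/-- Slot maps of the terms of a product of three tensors. -/
structure IsQuasiShuffle₃ (m n p : ℕ)
    (q : Σ k : ℕ, (Fin (m + 1) ⊕ Fin (n + 1)) ⊕ Fin (p + 1) → Fin (k + 1)) : Prop where
  zero₁ : q.2 (Sum.inl (Sum.inl 0)) = 0
  zero₂ : q.2 (Sum.inl (Sum.inr 0)) = 0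
  zero₃ : q.2 (Sum.inr 0) = 0
  mono₁ : StrictMono fun i => q.2 (Sum.inl (Sum.inl i))
  mono₂ : StrictMono fun i => q.2 (Sum.inl (Sum.inr i))
  mono₃ : StrictMono fun i => q.2 (Sum.inr i)
  surj : Function.Surjective q.2

/-- Composition of slot maps. -/
def compQuasiShuffle (m n p : ℕ)
    (x : Σ H : {H // IsQuasiShuffle m n H}, {G // IsQuasiShuffle H.1.1 p G}) :
    {q // IsQuasiShuffle₃ m n p q} :=
  ⟨⟨x.2.1.1, x.2.1.2 ∘ Sum.map x.1.1.2 id⟩, by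
    obtain ⟨⟨H, hH⟩, ⟨G, hG⟩⟩ := x
    exact
      { zero₁ := by simpa [hH.inl_zero] using hG.inl_zero
        zero₂ := by simpa [hH.inr_zero] using hG.inl_zero
        zero₃ := by simpa using hG.inr_zero
        mono₁ := hG.inl_mono.comp hH.inl_mono
        mono₂ := hG.inl_mono.comp hH.inr_mono
        mono₃ := hG.inr_mono
        surj := hG.surj.comp (Sum.map_surjective.2 ⟨hH.surj, Function.surjective_id⟩) }⟩

theorem compQuasiShuffle_bijective (m n p : ℕ) : Function.Bijective (compQuasiShuffle m n p) := by
  constructor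
  · rintro ⟨⟨⟨k, H⟩, hH⟩, ⟨⟨l, G⟩, hG⟩⟩ ⟨⟨⟨k', H'⟩, hH'⟩, ⟨⟨l', G'⟩, hG'⟩⟩ h
    have h0 := congrArg Subtype.val h
    dsimp only at G G' hG hG'
    obtain rfl : l = l' := congrArg Sigma.fst h0
    have h1 : G ∘ Sum.map H id = G' ∘ Sum.map H' id := eq_of_heq (Sigma.mk.inj h0).2
    obtain ⟨rfl, h2, h3⟩ := factor_unique hH.surj hH'.surj hG.inl_mono hG'.inl_mono
      fun i => congrFun h1 (Sum.inl i)
    obtain rfl : H = H' := funext fun i => Fin.ext (h2 i)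
    obtain rfl : G = G' := by
      funext i
      rcases i with i | i
      · exact h3 i i.2 i.2
      · exact congrFun h1 (Sum.inr i)
    rfl
  · rintro ⟨⟨l, K⟩, hK⟩
    obtain ⟨k, H, g, hH, hg, hgH⟩ := factor_exists fun i => K (Sum.inl i)
    have hg0 : g 0 = 0 := by
      have h1 := hg.monotone (Fin.zero_le (H (Sum.inl 0)))
      rw [hgH] at h1
      have h2 := hK.zero₁
      dsimp only at h2
      rw [h2] at h1
      exact Fin.le_zero_iff.1 h1
    refine ⟨⟨⟨⟨k, H⟩, ?_, ?_, ?_, ?_, hH⟩,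
      ⟨⟨l, Sum.elim g fun i => K (Sum.inr i)⟩, hg0, hK.zero₃, hg, hK.mono₃, ?_⟩⟩, ?_⟩
    · exact hg.injective ((hgH _).trans (hK.zero₁.trans hg0.symm))
    · exact hg.injective ((hgH _).trans (hK.zero₂.trans hg0.symm))
    · intro a b hab
      rw [← hg.lt_iff_lt, hgH, hgH]
      exact hK.mono₁ hab
    · intro a b hab
      rw [← hg.lt_iff_lt, hgH, hgH]
      exact hK.mono₂ hab
    · intro j
      obtain ⟨i, hi⟩ := hK.surj j
      rcases i with i | i
      · exact ⟨Sum.inl (H i), (hgH i).trans hi⟩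
      · exact ⟨Sum.inr i, hi⟩
    · refine Subtype.ext (sigma_ext rfl ?_)
      rintro (i | i)
      · exact congrArg Fin.val (hgH i)
      · rfl

/-- Slot maps for three factors are obtained by composition of slot maps for two factors. -/
noncomputable def compEquiv (m n p : ℕ) :
    (Σ H : {H // IsQuasiShuffle m n H}, {G // IsQuasiShuffle H.1.1 p G}) ≃
      {q // IsQuasiShuffle₃ m n p q} :=
  Equiv.ofBijective _ (compQuasiShuffle_bijective m n p)

noncomputable instance (m n p : ℕ) : Fintype {q // IsQuasiShuffle₃ m n p q} :=
  Fintype.ofEquiv _ (compEquiv m n p)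

/-- Cyclic rotation of three factors. -/
def rotate (α β γ : Type*) : (β ⊕ γ) ⊕ α ≃ (α ⊕ β) ⊕ γ :=
  (Equiv.sumComm _ _).trans (Equiv.sumAssoc _ _ _).symm

/-- Cyclic rotation of slot maps. -/
def rotateEquiv (m n p : ℕ) :
    {q // IsQuasiShuffle₃ m n p q} ≃ {q // IsQuasiShuffle₃ n p m q} where
  toFun q := ⟨⟨q.1.1, q.1.2 ∘ rotate _ _ _⟩, q.2.zero₂, q.2.zero₃, q.2.zero₁, q.2.mono₂,
    q.2.mono₃, q.2.mono₁, q.2.surj.comp (Equiv.surjective _)⟩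
  invFun q := ⟨⟨q.1.1, q.1.2 ∘ (rotate _ _ _).symm⟩, q.2.zero₃, q.2.zero₁, q.2.zero₂, q.2.mono₃,
    q.2.mono₁, q.2.mono₂, q.2.surj.comp (Equiv.surjective _)⟩
  left_inv q := Subtype.ext (sigma_ext rfl fun i => by simp)
  right_inv q := Subtype.ext (sigma_ext rfl fun i => by simp)

/-- Exchange of two factors. -/
def swapEquiv (m n : ℕ) :
    {q // IsQuasiShuffle m n q} ≃ {q // IsQuasiShuffle n m q} where
  toFun q := ⟨⟨q.1.1, q.1.2 ∘ Sum.swap⟩, q.2.inr_zero, q.2.inl_zero, q.2.inr_mono, q.2.inl_mono,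
    q.2.surj.comp (Equiv.sumComm _ _).surjective⟩
  invFun q := ⟨⟨q.1.1, q.1.2 ∘ Sum.swap⟩, q.2.inr_zero, q.2.inl_zero, q.2.inr_mono, q.2.inl_mono,
    q.2.surj.comp (Equiv.sumComm _ _).surjective⟩
  left_inv q := Subtype.ext (sigma_ext rfl fun i => by simp)
  right_inv q := Subtype.ext (sigma_ext rfl fun i => by simp)

theorem IsQuasiShuffle.fst_le {m n : ℕ} (p : {p // IsQuasiShuffle m n p}) : p.1.1 ≤ m + n := by
  obtain ⟨s, rfl⟩ := MixableShuffle.toQuasiShuffle_surjective p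
  exact Nat.sub_le _ _

theorem isQuasiShuffle_zero (n : ℕ) :
    IsQuasiShuffle 0 n ⟨n, Sum.elim (fun _ => 0) id⟩ where
  inl_zero := rfl
  inr_zero := rfl
  inl_mono a b h := absurd h (by omega)
  inr_mono := strictMono_id
  surj j := ⟨Sum.inr j, rfl⟩

theorem eq_isQuasiShuffle_zero {n : ℕ} (p : {p // IsQuasiShuffle 0 n p}) :
    p = ⟨_, isQuasiShuffle_zero n⟩ := by
  obtain ⟨⟨k, H⟩, hH⟩ := p
  have hs : Function.Surjective fun i => H (Sum.inr i) := by
    intro j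
    obtain ⟨i | i, hi⟩ := hH.surj j
    · obtain rfl : i = 0 := Fin.fin_one_eq_zero i
      exact ⟨0, hH.inr_zero.trans (hH.inl_zero.symm.trans hi)⟩
    · exact ⟨i, hi⟩
  obtain ⟨h1, h2, -⟩ := factor_unique (H := id) (H' := fun i => H (Sum.inr i))
    (g := fun i => H (Sum.inr i)) (g' := id) Function.surjective_id hs hH.inr_mono strictMono_id
    fun _ => rfl
  refine Subtype.ext (sigma_ext h1.symm ?_)
  rintro (i | i)
  · obtain rfl : i = 0 := Fin.fin_one_eq_zero i
    exact congrArg Fin.val hH.inl_zero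
  · exact (h2 i).symm

end ShuffleBaxter

namespace ShuffleBaxterAlgebra

open ShuffleBaxter

variable {C A : Type*} [CommRing C] [CommRing A] [Algebra C A] {wt : C}

variable (C wt) in
/-- The tensor obtained by multiplying each entry of `x` into its slot. -/
noncomputable def term {ι : Type*} [Fintype ι] (p : Σ k : ℕ, ι → Fin (k + 1)) (x : ι → A) :
    ShuffleBaxterAlgebra C A wt :=
  incl wt p.1 (collapse C p.2 x)

theorem term_comp {ι ι' : Type*} [Fintype ι] [Fintype ι'] (e : ι' ≃ ι) (k : ℕ)
    (H : ι → Fin (k + 1)) (x : ι → A) : term C wt ⟨k, H ∘ e⟩ (x ∘ e) = term C wt ⟨k, H⟩ x := by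
  change incl wt k (PiTensorProduct.tprod C _) = incl wt k (PiTensorProduct.tprod C _)
  congr 2
  funext j
  rw [Finset.prod_filter, Finset.prod_filter, ← Equiv.prod_comp e]
  rfl

theorem incl_mul_incl_eq_sum (m n : ℕ) (x : Fin (m + 1) → A) (y : Fin (n + 1) → A) :
    incl wt m (PiTensorProduct.tprod C x) * incl wt n (PiTensorProduct.tprod C y) =
      ∑ p : {p // IsQuasiShuffle m n p}, wt ^ (m + n - p.1.1) • term C wt p.1 (Sum.elim x y) := by
  rw [incl_tprod_mul]
  refine Fintype.sum_equiv (MixableShuffle.equivQuasiShuffle m n) _ _ fun s => ?_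
  have h : s.T.card = m + n - (m + n - s.T.card) := by
    have : s.T.card ≤ m + n := by simpa using s.T.card_le_univ
    omega
  have h' : wt ^ s.T.card = wt ^ (m + n - (m + n - s.T.card)) := congrArg _ h
  rw [h']
  rfl

theorem smul_mul' (c : C) (x y : ShuffleBaxterAlgebra C A wt) : (c • x) * y = c • (x * y) := by
  simp only [mul_def, map_smul, LinearMap.smul_apply]

theorem sum_mul' {α : Type*} (s : Finset α) (f : α → ShuffleBaxterAlgebra C A wt)
    (y : ShuffleBaxterAlgebra C A wt) : (∑ i ∈ s, f i) * y = ∑ i ∈ s, f i * y := by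
  simp only [mul_def, map_sum, LinearMap.sum_apply]

theorem incl_mul_incl_mul_incl (m n p : ℕ) (x : Fin (m + 1) → A) (y : Fin (n + 1) → A)
    (z : Fin (p + 1) → A) :
    incl wt m (PiTensorProduct.tprod C x) * incl wt n (PiTensorProduct.tprod C y) *
        incl wt p (PiTensorProduct.tprod C z) =
      ∑ q : {q // IsQuasiShuffle₃ m n p q},
        wt ^ (m + n + p - q.1.1) • term C wt q.1 (Sum.elim (Sum.elim x y) z) := by
  have h1 : ∀ H : {H // IsQuasiShuffle m n H}, term C wt H.1 (Sum.elim x y) =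
      incl wt H.1.1 (PiTensorProduct.tprod C
        fun j => ∏ i with H.1.2 i = j, (Sum.elim x y : _ → A) i) := fun _ => rfl
  rw [incl_mul_incl_eq_sum, sum_mul']
  simp only [smul_mul', h1, incl_mul_incl_eq_sum, Finset.smul_sum, smul_smul]
  rw [← Fintype.sum_sigma']
  refine Fintype.sum_equiv (compEquiv m n p) _ _ fun X => ?_
  obtain ⟨H, G⟩ := X
  have hH := IsQuasiShuffle.fst_le H
  have hG := IsQuasiShuffle.fst_le G
  rw [← pow_add]
  congr 1
  · congr 1
    change (m + n - H.1.1) + (H.1.1 + p - G.1.1) = m + n + p - G.1.1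
    omega
  · change incl wt G.1.1 (PiTensorProduct.tprod C _) = incl wt G.1.1 (PiTensorProduct.tprod C _)
    congr 2
    funext j
    rw [Finset.prod_filter, Fintype.prod_sum_type, Finset.prod_filter, Fintype.prod_sum_type]
    congr 1
    rw [← Finset.prod_fiberwise (s := Finset.univ) (g := H.1.2)]
    refine Finset.prod_congr rfl fun k _ => ?_
    by_cases hk : G.1.2 (Sum.inl k) = j
    · rw [if_pos hk]
      refine Finset.prod_congr rfl fun i hi => ?_
      have hi' := (Finset.mem_filter.1 hi).2
      change _ = if G.1.2 (Sum.inl (H.1.2 i)) = j then _ else _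
      rw [hi', if_pos hk]
      rfl
    · rw [if_neg hk]
      refine (Finset.prod_eq_one fun i hi => ?_).symm
      have hi' := (Finset.mem_filter.1 hi).2
      change (if G.1.2 (Sum.inl (H.1.2 i)) = j then _ else _) = _
      rw [hi', if_neg hk]

theorem incl_mul_comm (m n : ℕ) (x : Fin (m + 1) → A) (y : Fin (n + 1) → A) :
    incl wt m (PiTensorProduct.tprod C x) * incl wt n (PiTensorProduct.tprod C y) =
      incl wt n (PiTensorProduct.tprod C y) * incl wt m (PiTensorProduct.tprod C x) := by
  rw [incl_mul_incl_eq_sum, incl_mul_incl_eq_sum]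
  refine Fintype.sum_equiv (swapEquiv m n) _ _ fun p => ?_
  rw [← term_comp (Equiv.sumComm _ _) p.1.1 p.1.2, add_comm m n]
  congr 2
  funext i
  rcases i with i | i <;> rfl

theorem mul_comm' (x y : ShuffleBaxterAlgebra C A wt) : x * y = y * x := by
  have h : mulLinear C A wt = (mulLinear C A wt).flip :=
    hom_ext fun m x => hom_ext fun n y => incl_mul_comm m n x y
  exact congrFun (congrArg DFunLike.coe (congrFun (congrArg DFunLike.coe h) x)) y

theorem incl_rotate (m n p : ℕ) (x : Fin (m + 1) → A) (y : Fin (n + 1) → A)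
    (z : Fin (p + 1) → A) :
    incl wt m (PiTensorProduct.tprod C x) * incl wt n (PiTensorProduct.tprod C y) *
        incl wt p (PiTensorProduct.tprod C z) =
      incl wt n (PiTensorProduct.tprod C y) * incl wt p (PiTensorProduct.tprod C z) *
        incl wt m (PiTensorProduct.tprod C x) := by
  rw [incl_mul_incl_mul_incl, incl_mul_incl_mul_incl]
  refine Fintype.sum_equiv (rotateEquiv m n p) _ _ fun q => ?_
  rw [← term_comp (rotate _ _ _) q.1.1 q.1.2, show m + n + p = n + p + m by omega]
  congr 2
  funext i
  rcases i with (i | i) | i <;> rfl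

theorem mul_assoc' (x y z : ShuffleBaxterAlgebra C A wt) : x * y * z = x * (y * z) := by
  let L := mulLinear C A wt
  have h₀ : ∀ (m n p : ℕ) (x : Fin (m + 1) → A) (y : Fin (n + 1) → A) (z : Fin (p + 1) → A),
      incl wt m (PiTensorProduct.tprod C x) * incl wt n (PiTensorProduct.tprod C y) *
          incl wt p (PiTensorProduct.tprod C z) =
        incl wt m (PiTensorProduct.tprod C x) * (incl wt n (PiTensorProduct.tprod C y) *
          incl wt p (PiTensorProduct.tprod C z)) := fun m n p x y z =>
    (incl_rotate m n p x y z).trans (mul_comm' _ _)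
  have h₁ : ∀ (m n : ℕ) (x : Fin (m + 1) → A) (y : Fin (n + 1) → A)
      (z : ShuffleBaxterAlgebra C A wt),
      incl wt m (PiTensorProduct.tprod C x) * incl wt n (PiTensorProduct.tprod C y) * z =
        incl wt m (PiTensorProduct.tprod C x) * (incl wt n (PiTensorProduct.tprod C y) * z) := by
    intro m n x y z
    exact LinearMap.congr_fun (f := L (L (incl wt m (PiTensorProduct.tprod C x))
      (incl wt n (PiTensorProduct.tprod C y)))) (g := L (incl wt m (PiTensorProduct.tprod C x)) ∘ₗ
        L (incl wt n (PiTensorProduct.tprod C y))) (hom_ext fun p z => h₀ m n p x y z) z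
  have h₂ : ∀ (m : ℕ) (x : Fin (m + 1) → A) (y z : ShuffleBaxterAlgebra C A wt),
      incl wt m (PiTensorProduct.tprod C x) * y * z =
        incl wt m (PiTensorProduct.tprod C x) * (y * z) := by
    intro m x y z
    exact LinearMap.congr_fun (f := L.flip z ∘ₗ L (incl wt m (PiTensorProduct.tprod C x)))
      (g := L (incl wt m (PiTensorProduct.tprod C x)) ∘ₗ L.flip z)
      (hom_ext fun n y => h₁ m n x y z) y
  exact LinearMap.congr_fun (f := L.flip z ∘ₗ L.flip y) (g := L.flip (L y z))
    (hom_ext fun m x => h₂ m x y z) x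

theorem one_mul' (x : ShuffleBaxterAlgebra C A wt) : 1 * x = x := by
  have h : mulLinear C A wt 1 = LinearMap.id := hom_ext fun n y => by
    change incl wt 0 (PiTensorProduct.tprod C fun _ => 1) * incl wt n (PiTensorProduct.tprod C y) =
      incl wt n (PiTensorProduct.tprod C y)
    rw [incl_mul_incl_eq_sum, Fintype.sum_eq_single ⟨_, isQuasiShuffle_zero n⟩
      fun p hp => absurd (eq_isQuasiShuffle_zero p) hp]
    change wt ^ (0 + n - n) • incl wt n (PiTensorProduct.tprod C _) = _
    rw [zero_add, Nat.sub_self, pow_zero, one_smul]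
    congr 2
    have h : ∀ j : Fin (n + 1), (∏ i with Sum.elim (fun _ : Fin (0 + 1) => 0) id i = j,
        Sum.elim (fun _ => 1) y i) = y j := fun j => by
      rw [Finset.prod_filter, Fintype.prod_sum_type]
      refine (congrArg₂ (· * ·) (Finset.prod_eq_one fun i _ => ?_)
        (Fintype.prod_eq_single j fun i hi => if_neg hi)).trans ((one_mul _).trans (if_pos rfl))
      split_ifs <;> rfl
    exact funext h
  exact congrFun (congrArg DFunLike.coe h) x

noncomputable instance instCommRing : CommRing (ShuffleBaxterAlgebra C A wt) where
  __ := (inferInstance : AddCommGroup (ShuffleBaxterAlgebra C A wt))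
  mul_assoc := mul_assoc'
  mul_comm := mul_comm'
  one_mul := one_mul'
  mul_one x := (mul_comm' x 1).trans (one_mul' x)
  left_distrib x y z := map_add (mulLinear C A wt x) y z
  right_distrib x y z := by simp only [mul_def, map_add, LinearMap.add_apply]
  zero_mul x := by simp only [mul_def, map_zero, LinearMap.zero_apply]
  mul_zero x := map_zero (mulLinear C A wt x)

end ShuffleBaxterAlgebra

/-- For a `C`-module `N` annihilated by the ideal `I`, hence a `C/I`-module, the `C/I`-torsion of
`N`: the elements that are annihilated by a non-zero element of `C/I`. -/
def quotientTorsion {C : Type*} [CommRing C] (I : Ideal C) (N : Type*) [AddCommGroup N]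
    [Module C N] : Set N :=
  {x | ∃ r : C, Ideal.Quotient.mk I r ≠ 0 ∧ r • x = 0}

/-! From the domain property to torsion-freeness: `A` is a subring of the shuffle algebra, as the
summand `A^{⊗1}`, and a scalar `r` acts as multiplication by the image of `r` in that subring. So if
the algebra is a domain, then `A` is one and a scalar with non-zero image kills no non-zero tensor
(`eq_zero_of_smul_eq_zero`).

Conversely, let `X`, `Y` be non-zero with top components in degrees `m`, `n`. Each pair in `T`
lowers the degree by one, so the component of `X * Y` in degree `m + n` is the ordinary shuffle
product of the top components, whatever the weight. `A` need not be free over `C`, but up to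
denominators it behaves as if it were: `exists_dualFamily` gives elements of `A` that are a basis of
its span in the fraction field `K`, over the subfield generated by `C`, with coordinate functionals.
They yield functionals `coeff f w` on tensors, indexed by words `w`; torsion-freeness makes these
separate points (`exists_coeff_ne_zero`), and only finitely many are non-zero on a given tensor. On
a shuffle product, `coeff f w` is a sum over shuffles of products of coefficients at the two
subwords (`coeff_proj_incl_mul_incl`). Evaluated at the largest shuffle of the two lexicographically
largest words, this sum is a positive integer times a product of non-zero elements of `K`, hence
non-zero in characteristic zero (`exists_sum_shuffle_ne_zero`).

Torsion-freeness is equivalent to injectivity because the kernel of localization at the non-zero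
elements of a domain is the torsion (`injective_mk_fractionRing_iff`). -/

namespace Submodule

/-! ### Saturation of a submodule: working up to denominators. -/

variable {R M : Type*} [CommRing R] [AddCommGroup M] [Module R M]

/-- The saturation of a submodule `N` with respect to a submonoid `S` of the base ring: the elements
that some element of `S` multiplies into `N`. -/
def saturateBy (S : Submonoid R) (N : Submodule R M) : Submodule R M where
  carrier := {x | ∃ r ∈ S, r • x ∈ N}
  zero_mem' := ⟨1, S.one_mem, by simp⟩
  add_mem' := by
    rintro x y ⟨r, hr, hx⟩ ⟨s, hs, hy⟩
    refine ⟨r * s, S.mul_mem hr hs, ?_⟩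
    rw [smul_add, mul_comm, mul_smul, mul_comm, mul_smul]
    exact N.add_mem (N.smul_mem _ hx) (N.smul_mem _ hy)
  smul_mem' := by
    rintro c x ⟨r, hr, hx⟩
    exact ⟨r, hr, by rw [smul_comm]; exact N.smul_mem _ hx⟩

theorem mem_saturateBy_of_mem {S : Submonoid R} {N : Submodule R M} {x : M} (h : x ∈ N) :
    x ∈ saturateBy S N := ⟨1, S.one_mem, by rwa [one_smul]⟩

theorem mem_saturateBy_of_smul_mem {S : Submonoid R} {N : Submodule R M} {x : M} {r : R}
    (hr : r ∈ S) (h : r • x ∈ saturateBy S N) : x ∈ saturateBy S N := by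
  obtain ⟨s, hs, h⟩ := h
  exact ⟨s * r, S.mul_mem hs hr, by rwa [mul_smul]⟩

end Submodule

/-! ### Dual families and coefficients of tensors with respect to words. -/

namespace ShuffleBaxter

/-- The elements of `C` with non-zero image in the domain `A`. -/
def nonzeroScalars (C A : Type*) [CommRing C] [CommRing A] [IsDomain A] [Algebra C A] :
    Submonoid C :=
  (nonZeroDivisors A).comap (algebraMap C A)

theorem mem_nonzeroScalars {C A : Type*} [CommRing C] [CommRing A] [IsDomain A] [Algebra C A]
    {r : C} : r ∈ nonzeroScalars C A ↔ algebraMap C A r ≠ 0 := by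
  rw [nonzeroScalars, Submonoid.mem_comap, mem_nonZeroDivisors_iff_ne_zero]

/-- In a `C`-algebra `A` that is a domain there is a family whose `C`-span is everything up to
denominators in `C`, together with a dual family of `C`-linear functionals with values in the
fraction field of `A`. -/
theorem exists_dualFamily.{u} (C : Type*) (A : Type u) (K : Type*) [CommRing C] [CommRing A]
    [IsDomain A] [Field K] [Algebra C A] [Algebra A K] [Algebra C K] [IsScalarTower C A K]
    [IsFractionRing A K] :
    ∃ (B : Type u) (b : B → A) (f : B → A →ₗ[C] K),
      (∀ i, f i (b i) = 1) ∧ (∀ i j, i ≠ j → f i (b j) = 0) ∧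
        (Submodule.span C (Set.range b)).saturateBy (nonzeroScalars C A) = ⊤ := by
  let ι : A →ₗ[C] K := (IsScalarTower.toAlgHom C A K).toLinearMap
  have hinj : Function.Injective ι := IsFractionRing.injective A K
  -- `F` is the copy inside `K` of the fraction field of the image of `C`.
  obtain ⟨F, hF⟩ : ∃ F : Subfield K, F = Subfield.closure (Set.range (algebraMap C K)) := ⟨_, rfl⟩
  have hCF : ∀ c, algebraMap C K c ∈ F := fun c => hF ▸ Subfield.subset_closure ⟨c, rfl⟩
  -- The basis of the `F`-span of `A` is selected among the elements of `A` itself, so that the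
  -- words formed from it are tensors over `A`.
  obtain ⟨B, b, -, hspan, hli⟩ := exists_linearIndependent' F (fun a => ι a)
  have hmem : ∀ a, ι a ∈ Submodule.span F (Set.range ((fun a => ι a) ∘ b)) := fun a => by
    rw [hspan]
    exact Submodule.subset_span ⟨a, rfl⟩
  have hsmul : ∀ (c : C) (x : K), c • x = (⟨algebraMap C K c, hCF c⟩ : F) • x := fun c x =>
    Algebra.smul_def c x
  -- `f i` is the `i`-th coordinate in this basis; it is `C`-linear because `C` acts on `K` through
  -- `F`.
  refine ⟨B, b, fun i =>
    { toFun := fun a => (hli.repr ⟨ι a, hmem a⟩ i : K)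
      map_add' := fun x y => ?_
      map_smul' := fun c x => ?_ }, fun i => ?_, fun i j hij => ?_, ?_⟩
  · have : (⟨ι (x + y), hmem _⟩ : Submodule.span F (Set.range ((fun a => ι a) ∘ b))) =
        ⟨ι x, hmem x⟩ + ⟨ι y, hmem y⟩ := Subtype.ext (map_add ι x y)
    rw [this, map_add]
    rfl
  · have : (⟨ι (c • x), hmem _⟩ : Submodule.span F (Set.range ((fun a => ι a) ∘ b))) =
        (⟨algebraMap C K c, hCF c⟩ : F) • ⟨ι x, hmem x⟩ :=
      Subtype.ext ((map_smul ι c x).trans (hsmul _ _))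
    rw [this, map_smul, RingHom.id_apply, hsmul]
    rfl
  · change ((hli.repr ⟨ι (b i), hmem (b i)⟩ i : F) : K) = 1
    rw [hli.repr_eq_single i _ rfl, Finsupp.single_eq_same]
    rfl
  · change ((hli.repr ⟨ι (b j), hmem (b j)⟩ i : F) : K) = 0
    rw [hli.repr_eq_single j _ rfl, Finsupp.single_eq_of_ne hij]
    rfl
  -- Clearing the denominators of the finitely many coefficients in `F` turns an `F`-combination
  -- into a `C`-combination.
  · have key : ∀ x ∈ Submodule.span F (Set.range ((fun a => ι a) ∘ b)),
        ∃ r ∈ nonzeroScalars C A, ∃ y ∈ Submodule.span C (Set.range b), r • x = ι y := by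
      intro x hx
      induction hx using Submodule.span_induction with
      | mem x h =>
        obtain ⟨i, rfl⟩ := h
        exact ⟨1, Submonoid.one_mem _, b i, Submodule.subset_span ⟨i, rfl⟩, one_smul _ _⟩
      | zero => exact ⟨1, Submonoid.one_mem _, 0, Submodule.zero_mem _, by simp⟩
      | add x y _ _ hx hy =>
        obtain ⟨r, hr, x', hx', hrx⟩ := hx
        obtain ⟨s, hs, y', hy', hsy⟩ := hy
        refine ⟨s * r, Submonoid.mul_mem _ hs hr, s • x' + r • y',
          Submodule.add_mem _ (Submodule.smul_mem _ _ hx') (Submodule.smul_mem _ _ hy'), ?_⟩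
        rw [smul_add, mul_smul, hrx, mul_comm, mul_smul, hsy, map_add, map_smul, map_smul]
      | smul c x _ hx =>
        obtain ⟨r, hr, x', hx', hrx⟩ := hx
        obtain ⟨c, hc⟩ := c
        obtain ⟨p, hp, q, hq, rfl⟩ := Subfield.mem_closure_iff.1 (hF ▸ hc)
        rw [← RingHom.coe_range, Subring.closure_eq] at hp hq
        obtain ⟨p, rfl⟩ := hp
        obtain ⟨q, rfl⟩ := hq
        by_cases hq : algebraMap C A q = 0
        -- Division by zero gives zero in `K`, so here the scalar `p / q` is zero.
        · refine ⟨1, Submonoid.one_mem _, 0, Submodule.zero_mem _, ?_⟩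
          have : algebraMap C K q = 0 := by
            rw [IsScalarTower.algebraMap_apply C A K, hq, map_zero]
          rw [Subfield.smul_def]
          simp [this]
        · refine ⟨q * r, Submonoid.mul_mem _ (mem_nonzeroScalars.2 hq) hr, p • x',
            Submodule.smul_mem _ _ hx', ?_⟩
          have hq' : algebraMap C K q ≠ 0 := by
            rw [IsScalarTower.algebraMap_apply C A K]
            exact fun h => hq (hinj (h.trans (map_zero ι).symm))
          rw [map_smul, ← hrx, Subfield.smul_def]
          change (q * r) • (algebraMap C K p / algebraMap C K q * x) = p • r • x
          simp only [Algebra.smul_def, map_mul]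
          field_simp
    rw [eq_top_iff]
    rintro a -
    obtain ⟨r, hr, y, hy, h⟩ := key _ (hmem a)
    refine ⟨r, hr, ?_⟩
    rwa [hinj ((map_smul ι r a).trans h)]

section Coeff

variable {C A K B : Type*} [CommRing C] [CommRing A] [CommRing K] [Algebra C A] [Algebra A K]
  [Algebra C K] [IsScalarTower C A K]

/-- The functional `x₀ ⊗ ⋯ ⊗ xₘ ↦ x₀ ∏ⱼ f (w j) (xⱼ)`. -/
noncomputable def coeff (f : B → A →ₗ[C] K) {m : ℕ} (w : Fin m → B) : (⨂[C]^(m + 1) A) →ₗ[C] K :=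
  PiTensorProduct.lift ((MultilinearMap.mkPiAlgebra C (Fin (m + 1)) K).compLinearMap
    (Fin.cons (IsScalarTower.toAlgHom C A K).toLinearMap fun j => f (w j) :
      Fin (m + 1) → A →ₗ[C] K))

theorem coeff_tprod (f : B → A →ₗ[C] K) {m : ℕ} (w : Fin m → B) (x : Fin (m + 1) → A) :
    coeff f w (PiTensorProduct.tprod C x) = algebraMap A K (x 0) * ∏ j, f (w j) (x j.succ) := by
  simp [coeff, Fin.prod_univ_succ]

/-- The map `a ↦ a ⊗ b (w 1) ⊗ ⋯ ⊗ b (w m)`. -/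
noncomputable def wordTensor (b : B → A) {m : ℕ} (w : Fin m → B) : A →ₗ[C] ⨂[C]^(m + 1) A :=
  (PiTensorProduct.tprod C).toLinearMap (Fin.cons 0 (b ∘ w) : Fin (m + 1) → A) 0

theorem wordTensor_apply (b : B → A) {m : ℕ} (w : Fin m → B) (a : A) :
    wordTensor b w a = PiTensorProduct.tprod C (Fin.cons a (b ∘ w) : Fin (m + 1) → A) := by
  rw [wordTensor, MultilinearMap.toLinearMap_apply, Fin.update_cons_zero]

/-- The combination of the words `b (w 1) ⊗ ⋯ ⊗ b (w m)` with given coefficients in `A`. -/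
noncomputable def wordSum (b : B → A) (m : ℕ) : ((Fin m → B) →₀ A) →ₗ[C] ⨂[C]^(m + 1) A :=
  Finsupp.lsum C fun w => wordTensor b w

/-- Two different words differ at some position, where the dual functional vanishes; on equal words
every factor is `1` and only the entry in slot `0` remains. -/
theorem coeff_wordSum {b : B → A} {f : B → A →ₗ[C] K} (h1 : ∀ i, f i (b i) = 1)
    (h0 : ∀ i j, i ≠ j → f i (b j) = 0) {m : ℕ} (w : Fin m → B) (g : (Fin m → B) →₀ A) :
    coeff f w (wordSum (C := C) b m g) = algebraMap A K (g w) := by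
  classical
  have h : coeff f w ∘ₗ wordSum (C := C) b m =
      (IsScalarTower.toAlgHom C A K).toLinearMap ∘ₗ Finsupp.lapply w := by
    refine Finsupp.lhom_ext fun w' a => ?_
    simp only [LinearMap.comp_apply, wordSum, Finsupp.lsum_single, wordTensor_apply, coeff_tprod,
      Finsupp.lapply_apply, Fin.cons_zero, Fin.cons_succ, Function.comp, AlgHom.toLinearMap_apply,
      IsScalarTower.coe_toAlgHom']
    by_cases hw : w' = w
    · subst hw
      simp [h1]
    · obtain ⟨j, hj⟩ := Function.ne_iff.1 hw
      rw [Finset.prod_eq_zero (Finset.mem_univ j) (h0 _ _ hj.symm), mul_zero,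
        Finsupp.single_eq_of_ne (Ne.symm hw), map_zero]
  exact LinearMap.congr_fun h g

/-- Entries are replaced one slot at a time by combinations of the `b k`, each at the cost of a
denominator in `S`. Slot `0` needs no replacement, since the coefficients of words range over all of
`A`. -/
theorem saturateBy_range_wordSum {b : B → A} {S : Submonoid C}
    (hb : (Submodule.span C (Set.range b)).saturateBy S = ⊤) (m : ℕ) :
    (LinearMap.range (wordSum (C := C) b m)).saturateBy S = ⊤ := by
  classical
  set N := (LinearMap.range (wordSum (C := C) b m)).saturateBy S
  -- `s` contains the positions whose entries are still arbitrary.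
  have key : ∀ (s : Finset (Fin m)) (x : Fin (m + 1) → A), (∀ j ∉ s, x j.succ ∈ Set.range b) →
      PiTensorProduct.tprod C x ∈ N := by
    intro s
    induction s using Finset.induction_on with
    | empty =>
      intro x hx
      choose w hw using fun j => hx j (Finset.notMem_empty j)
      refine Submodule.mem_saturateBy_of_mem ⟨Finsupp.single w (x 0), ?_⟩
      rw [wordSum, Finsupp.lsum_single, wordTensor_apply]
      congr 1
      funext j
      refine Fin.cases rfl (fun j => ?_) j
      rw [Fin.cons_succ, Function.comp, hw]
    | insert i s _ ih =>
      intro x hx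
      let φ := (PiTensorProduct.tprod C).toLinearMap x i.succ
      -- `φ` varies the entry in slot `i.succ`. If that entry is some `b k`, one arbitrary position
      -- fewer is left and `ih` applies.
      have hφ : Submodule.span C (Set.range b) ≤ N.comap φ := by
        rw [Submodule.span_le]
        rintro _ ⟨k, rfl⟩
        refine ih _ fun j hj => ?_
        by_cases hij : j = i
        · subst hij
          rw [Function.update_self]
          exact ⟨k, rfl⟩
        · rw [Function.update_of_ne (by simpa using hij)]
          exact hx j (by simp [hij, hj])
      obtain ⟨r, hr, h⟩ := (hb ▸ Submodule.mem_top :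
        x i.succ ∈ (Submodule.span C (Set.range b)).saturateBy S)
      have h' := hφ h
      rw [Submodule.mem_comap, map_smul] at h'
      have h'' := Submodule.mem_saturateBy_of_smul_mem hr h'
      rwa [MultilinearMap.toLinearMap_apply, Function.update_eq_self] at h''
  rw [eq_top_iff, ← PiTensorProduct.span_tprod_eq_top, Submodule.span_le]
  rintro _ ⟨x, rfl⟩
  exact key Finset.univ x fun j hj => absurd (Finset.mem_univ j) hj

/-- A multiple of `x` by an element of `S` is a finite combination of words, and that element can be
cancelled in `K`. -/
theorem finite_coeff_ne_zero {b : B → A} {f : B → A →ₗ[C] K} (h1 : ∀ i, f i (b i) = 1)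
    (h0 : ∀ i j, i ≠ j → f i (b j) = 0) {S : Submonoid C}
    (hb : (Submodule.span C (Set.range b)).saturateBy S = ⊤)
    (hS : ∀ r ∈ S, ∀ x : K, r • x = 0 → x = 0) {m : ℕ} (x : ⨂[C]^(m + 1) A) :
    {w | coeff f w x ≠ 0}.Finite := by
  obtain ⟨r, hr, g, hg⟩ := (saturateBy_range_wordSum hb m ▸ Submodule.mem_top :
    x ∈ (LinearMap.range (wordSum (C := C) b m)).saturateBy S)
  refine g.support.finite_toSet.subset fun w hw => ?_
  rw [Finset.mem_coe, Finsupp.mem_support_iff]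
  intro hgw
  refine hw (hS r hr _ ?_)
  rw [← map_smul, ← hg, coeff_wordSum h1 h0, hgw, map_zero]

/-- This is where torsion-freeness of the tensor powers enters: if all coefficients vanish, the
combination of words that represents a multiple `r • x` is zero, and `r` can be cancelled. -/
theorem exists_coeff_ne_zero {b : B → A} {f : B → A →ₗ[C] K} (h1 : ∀ i, f i (b i) = 1)
    (h0 : ∀ i j, i ≠ j → f i (b j) = 0) {S : Submonoid C}
    (hb : (Submodule.span C (Set.range b)).saturateBy S = ⊤)
    (hK : Function.Injective (algebraMap A K)) {m : ℕ}
    (htf : ∀ r ∈ S, ∀ x : ⨂[C]^(m + 1) A, r • x = 0 → x = 0) {x : ⨂[C]^(m + 1) A} (hx : x ≠ 0) :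
    ∃ w, coeff f w x ≠ 0 := by
  obtain ⟨r, hr, g, hg⟩ := (saturateBy_range_wordSum hb m ▸ Submodule.mem_top :
    x ∈ (LinearMap.range (wordSum (C := C) b m)).saturateBy S)
  by_contra! h
  have hg0 : g = 0 := by
    ext w
    apply hK
    rw [← coeff_wordSum h1 h0, hg, map_smul, h, smul_zero, Finsupp.zero_apply, map_zero]
  exact hx (htf r hr x (by rw [← hg, hg0, map_zero]))

end Coeff

end ShuffleBaxter

/-! ### Lexicographic order on shuffled words. -/

namespace ShuffleBaxter

section Lex

variable {α β γ B : Type*}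

/-- The word on `γ` obtained by placing the letters of `u` and `v` according to `e`. -/
def merge (e : α ⊕ β ≃ γ) (u : α → B) (v : β → B) : γ → B := Sum.elim u v ∘ e.symm

theorem merge_comp_inl_comp_inr (e : α ⊕ β ≃ γ) (w : γ → B) :
    merge e (w ∘ e ∘ Sum.inl) (w ∘ e ∘ Sum.inr) = w := by
  funext k
  obtain ⟨i | i, rfl⟩ := e.surjective k <;> simp [merge]

theorem merge_apply_inl (e : α ⊕ β ≃ γ) (u : α → B) (v : β → B) (i : α) :
    merge e u v (e (Sum.inl i)) = u i := by simp [merge]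

theorem merge_apply_inr (e : α ⊕ β ≃ γ) (u : α → B) (v : β → B) (i : β) :
    merge e u v (e (Sum.inr i)) = v i := by simp [merge]

theorem merge_swap (e : α ⊕ β ≃ γ) (u : α → B) (v : β → B) :
    merge ((Equiv.sumComm β α).trans e) v u = merge e u v := by
  funext k
  obtain ⟨i | i, rfl⟩ := e.surjective k <;> simp [merge]

variable [LinearOrder γ] [LinearOrder B]

/-- The merged words first differ where the first differing letter of `u` and `u'` is placed: by
monotonicity, letters of the left word placed earlier have smaller index. -/
theorem toLex_merge_lt_left [LinearOrder α] {e : α ⊕ β ≃ γ} (he : StrictMono (e ∘ Sum.inl)) {u u' : α → B}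
    (v : β → B) (h : toLex u < toLex u') : toLex (merge e u v) < toLex (merge e u' v) := by
  obtain ⟨i, hi, hlt⟩ := h
  refine ⟨e (Sum.inl i), fun k hk => ?_, ?_⟩
  · obtain ⟨j | j, rfl⟩ := e.surjective k
    · simpa only [Pi.toLex_apply, merge_apply_inl] using hi j (he.lt_iff_lt.1 hk)
    · simp only [Pi.toLex_apply, merge_apply_inr]
  · simpa only [Pi.toLex_apply, merge_apply_inl] using hlt

theorem toLex_merge_lt_right [LinearOrder β] {e : α ⊕ β ≃ γ} (he : StrictMono (e ∘ Sum.inr)) (u : α → B)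
    {v v' : β → B} (h : toLex v < toLex v') : toLex (merge e u v) < toLex (merge e u v') := by
  rw [← merge_swap, ← merge_swap e u v']
  exact toLex_merge_lt_left (e := (Equiv.sumComm β α).trans e) he u h

variable [LinearOrder α] [LinearOrder β]

theorem toLex_merge_lt {e : α ⊕ β ≃ γ} [WellFoundedLT α] [WellFoundedLT β] [WellFoundedLT γ]
    (hl : StrictMono (e ∘ Sum.inl)) (hr : StrictMono (e ∘ Sum.inr)) {u u' : α → B} {v v' : β → B}
    (hu : toLex u ≤ toLex u') (hv : toLex v ≤ toLex v') (hne : ¬ (u = u' ∧ v = v')) :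
    toLex (merge e u v) < toLex (merge e u' v') := by
  rcases hu.eq_or_lt with hu | hu <;> rcases hv.eq_or_lt with hv | hv
  · exact absurd ⟨toLex.injective hu, toLex.injective hv⟩ hne
  · rw [toLex.injective hu]
    exact toLex_merge_lt_right hr _ hv
  · rw [toLex.injective hv]
    exact toLex_merge_lt_left hl _ hu
  · exact (toLex_merge_lt_left hl _ hu).trans (toLex_merge_lt_right hr _ hv)

/-- A non-empty sum of shuffles of two finite combinations of words is non-zero, by inspection of
the lexicographically largest word. -/
theorem exists_sum_shuffle_ne_zero {ι K : Type*} [Fintype ι] [Nonempty ι] [CommRing K] [IsDomain K]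
    [CharZero K] [WellFoundedLT α] [WellFoundedLT β] [WellFoundedLT γ] {e : ι → α ⊕ β ≃ γ}
    (hl : ∀ i, StrictMono (e i ∘ Sum.inl)) (hr : ∀ i, StrictMono (e i ∘ Sum.inr))
    {P : (α → B) → K} {Q : (β → B) → K} (hP : {u | P u ≠ 0}.Finite) (hQ : {v | Q v ≠ 0}.Finite)
    (hP0 : ∃ u, P u ≠ 0) (hQ0 : ∃ v, Q v ≠ 0) :
    ∃ w : γ → B, ∑ i, P (w ∘ e i ∘ Sum.inl) * Q (w ∘ e i ∘ Sum.inr) ≠ 0 := by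
  classical
  obtain ⟨u, hu, hu'⟩ := Set.exists_max_image _ toLex hP hP0
  obtain ⟨v, hv, hv'⟩ := Set.exists_max_image _ toLex hQ hQ0
  -- The placement `i₀` makes the merge of the two maximal words as large as possible.
  obtain ⟨i₀, hi₀⟩ := Finite.exists_max fun i => toLex (merge (e i) u v)
  refine ⟨merge (e i₀) u v, ?_⟩
  have key : ∀ i, P (merge (e i₀) u v ∘ e i ∘ Sum.inl) * Q (merge (e i₀) u v ∘ e i ∘ Sum.inr) =
      if merge (e i) u v = merge (e i₀) u v then P u * Q v else 0 := by
    intro i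
    split_ifs with h
    · congr 2 <;> funext j <;> simp only [← h, Function.comp, merge_apply_inl, merge_apply_inr]
    -- If term `i` is non-zero, the subwords of the maximal merge are at most `u` and `v`. They are
    -- not both equal to these, so strict monotonicity puts the maximal merge below `merge (e i) u
    -- v`, against the choice of `i₀`.
    · by_contra hne
      have h1 := hu' _ (left_ne_zero_of_mul hne)
      have h2 := hv' _ (right_ne_zero_of_mul hne)
      refine (hi₀ i).not_gt ?_
      have h3 := toLex_merge_lt (hl i) (hr i) h1 h2 fun ⟨h3, h4⟩ => h <| by
        conv_rhs => rw [← merge_comp_inl_comp_inr (e i) (merge (e i₀) u v)]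
        rw [h3, h4]
      rwa [merge_comp_inl_comp_inr] at h3
  simp only [key]
  -- The sum is `P u * Q v` times the number of placements with the maximal merge; `i₀` is one of
  -- them.
  rw [← Finset.sum_filter, Finset.sum_const, nsmul_eq_mul]
  refine mul_ne_zero (Nat.cast_ne_zero.2 (Finset.card_ne_zero_of_mem (a := i₀) ?_))
    (mul_ne_zero hu hv)
  simp

end Lex

/-! ### Terms of top degree as ordinary shuffles. -/

/-- The slot maps of the terms of top degree in a product of two tensors. -/
abbrev TopShuffle (m n : ℕ) := {p : {p // IsQuasiShuffle m n p} // p.1.1 = m + n}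

noncomputable instance (m n : ℕ) : Fintype (TopShuffle m n) :=
  Fintype.ofInjective _ Subtype.val_injective

instance (m n : ℕ) : Nonempty (TopShuffle m n) :=
  let s : MixableShuffle m n := ⟨Equiv.refl _, fun _ _ h => h, fun _ _ h => by simpa using h, ∅,
    fun _ h => absurd h (Finset.notMem_empty _)⟩
  ⟨⟨MixableShuffle.toQuasiShuffle m n s, rfl⟩⟩

/-- Slot `0` receives only the two entries of index `0`, so the other `m + n` entries map onto the
other `m + n` slots, hence bijectively. The shift by one discards slot `0`. -/
theorem TopShuffle.exists_equiv {m n : ℕ} (s : TopShuffle m n) :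
    ∃ e : Fin m ⊕ Fin n ≃ Fin (m + n), StrictMono (e ∘ Sum.inl) ∧ StrictMono (e ∘ Sum.inr) ∧
      (∀ i, (s.1.1.2 (Sum.inl i.succ) : ℕ) = e (Sum.inl i) + 1) ∧
      ∀ i, (s.1.1.2 (Sum.inr i.succ) : ℕ) = e (Sum.inr i) + 1 := by
  obtain ⟨⟨⟨k, H⟩, hH⟩, hk⟩ := s
  dsimp only at hk H hH ⊢
  subst hk
  have hl : ∀ i : Fin m, H (Sum.inl i.succ) ≠ 0 := fun i => by
    rw [← hH.inl_zero]
    exact (hH.inl_mono (Fin.succ_pos i)).ne'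
  have hr : ∀ i : Fin n, H (Sum.inr i.succ) ≠ 0 := fun i => by
    rw [← hH.inr_zero]
    exact (hH.inr_mono (Fin.succ_pos i)).ne'
  let g : Fin m ⊕ Fin n → Fin (m + n) :=
    Sum.elim (fun i => (H (Sum.inl i.succ)).pred (hl i)) fun i => (H (Sum.inr i.succ)).pred (hr i)
  have hg : Function.Surjective g := by
    intro j
    obtain ⟨i | i, hi⟩ := hH.surj j.succ
    · revert hi
      refine Fin.cases (fun hi => ?_) (fun i hi => ⟨Sum.inl i, ?_⟩) i
      · exact absurd (hi.symm.trans hH.inl_zero) (Fin.succ_ne_zero j)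
      · exact (Fin.pred_eq_iff_eq_succ (hl i)).2 hi
    · revert hi
      refine Fin.cases (fun hi => ?_) (fun i hi => ⟨Sum.inr i, ?_⟩) i
      · exact absurd (hi.symm.trans hH.inr_zero) (Fin.succ_ne_zero j)
      · exact (Fin.pred_eq_iff_eq_succ (hr i)).2 hi
  have hg' := (Fintype.bijective_iff_surjective_and_card g).2 ⟨hg, by simp⟩
  refine ⟨Equiv.ofBijective g hg', fun i j hij => ?_, fun i j hij => ?_, fun i => ?_, fun i => ?_⟩
  · exact (Fin.pred_lt_pred_iff (ha := hl i) (hb := hl j)).2 (hH.inl_mono (Fin.succ_lt_succ_iff.2 hij))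
  · exact (Fin.pred_lt_pred_iff (ha := hr i) (hb := hr j)).2 (hH.inr_mono (Fin.succ_lt_succ_iff.2 hij))
  · exact congrArg Fin.val (Fin.succ_pred _ (hl i)).symm
  · exact congrArg Fin.val (Fin.succ_pred _ (hr i)).symm

end ShuffleBaxter

/-! ### Components and the leading term of a product. -/

namespace ShuffleBaxterAlgebra

open ShuffleBaxter

variable {C A : Type*} [CommRing C] [CommRing A] [Algebra C A] {wt : C}

/-- The component in the summand `A^{⊗(k+1)}`. -/
noncomputable def proj (k : ℕ) : ShuffleBaxterAlgebra C A wt →ₗ[C] ⨂[C]^(k + 1) A :=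
  DirectSum.component C ℕ (fun k => ⨂[C]^(k + 1) A) k

theorem proj_incl_self (k : ℕ) (x : ⨂[C]^(k + 1) A) : proj k (incl wt k x) = x :=
  DirectSum.component.lof_self C (M := fun k : ℕ => ⨂[C]^(k + 1) A) k x

theorem proj_incl_of_ne {k l : ℕ} (h : l ≠ k) (x : ⨂[C]^(l + 1) A) :
    proj k (incl wt l x) = 0 :=
  (DirectSum.component.of C (M := fun k : ℕ => ⨂[C]^(k + 1) A) k l x).trans (dif_neg h)

theorem incl_injective (k : ℕ) : Function.Injective (incl (C := C) (A := A) wt k) :=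
  Function.LeftInverse.injective (proj_incl_self k)

theorem ext_proj {x y : ShuffleBaxterAlgebra C A wt} (h : ∀ k, proj k x = proj k y) : x = y :=
  DirectSum.ext_component C (M := fun k : ℕ => ⨂[C]^(k + 1) A) h

/-- `m` is the degree of `x`: the largest index in its finite support. -/
theorem exists_proj_ne_zero {x : ShuffleBaxterAlgebra C A wt} (hx : x ≠ 0) :
    ∃ m, proj m x ≠ 0 ∧ x = ∑ k ∈ Finset.range (m + 1), incl wt k (proj k x) := by
  classical
  have hfin : {k | proj k x ≠ 0}.Finite :=
    DFinsupp.finite_support (β := fun k : ℕ => ⨂[C]^(k + 1) A) x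
  have hne : ∃ k, proj k x ≠ 0 := by
    by_contra! h
    exact hx (ext_proj fun k => (h k).trans (map_zero _).symm)
  obtain ⟨m, hm, hmax⟩ := Set.exists_max_image _ id hfin hne
  refine ⟨m, hm, ext_proj fun j => ?_⟩
  rw [map_sum]
  by_cases hj : j ≤ m
  · rw [Finset.sum_eq_single_of_mem j (Finset.mem_range.2 (by omega))
      fun k _ hk => proj_incl_of_ne hk _, proj_incl_self]
  · rw [Finset.sum_eq_zero fun k hk => proj_incl_of_ne (by rw [Finset.mem_range] at hk; omega) _]
    by_contra h
    exact hj (hmax j h)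

theorem proj_incl_mul_incl_of_lt {m n d : ℕ} (h : m + n < d) (x : ⨂[C]^(m + 1) A)
    (y : ⨂[C]^(n + 1) A) : proj d (incl wt m x * incl wt n y) = 0 := by
  rw [incl_mul_incl, mulTensor]
  simp only [LinearMap.compr₂_apply, LinearMap.sum_apply, LinearMap.smul_apply,
    LinearMap.comp_apply, map_sum, map_smul]
  refine Finset.sum_eq_zero fun s _ => ?_
  rw [proj_incl_of_ne (by omega), smul_zero]

/-- In top degree, slot `0` holds `x 0 * y 0` and every other slot a single entry, so the product
defining the functional splits according to the origin of the entries. -/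
theorem coeff_proj_term {K B : Type*} [CommRing K] [Algebra A K] [Algebra C K]
    [IsScalarTower C A K] (f : B → A →ₗ[C] K) {m n : ℕ} (w : Fin (m + n) → B) (s : TopShuffle m n)
    (e : Fin m ⊕ Fin n ≃ Fin (m + n))
    (hl : ∀ i, (s.1.1.2 (Sum.inl i.succ) : ℕ) = e (Sum.inl i) + 1)
    (hr : ∀ i, (s.1.1.2 (Sum.inr i.succ) : ℕ) = e (Sum.inr i) + 1)
    (x : Fin (m + 1) → A) (y : Fin (n + 1) → A) :
    coeff f w (proj (m + n) (term C wt s.1.1 (Sum.elim x y))) =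
      coeff f (w ∘ e ∘ Sum.inl) (PiTensorProduct.tprod C x) *
        coeff f (w ∘ e ∘ Sum.inr) (PiTensorProduct.tprod C y) := by
  obtain ⟨⟨⟨k, H⟩, hH⟩, hk⟩ := s
  dsimp only at hk H hH hl hr ⊢
  subst hk
  have hl' : ∀ i, H (Sum.inl i.succ) = (e (Sum.inl i)).succ := fun i => Fin.ext (hl i)
  have hr' : ∀ i, H (Sum.inr i.succ) = (e (Sum.inr i)).succ := fun i => Fin.ext (hr i)
  have hl0 : H (Sum.inl 0) = 0 := hH.inl_zero
  have hr0 : H (Sum.inr 0) = 0 := hH.inr_zero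
  have h0 : ∏ i with H i = 0, (Sum.elim x y : _ → A) i = x 0 * y 0 := by
    rw [Finset.prod_filter, Fintype.prod_sum_type, Fin.prod_univ_succ, Fin.prod_univ_succ]
    simp [hl', hr', hl0, hr0, Fin.succ_ne_zero]
  have h1 : ∀ j, ∏ i with H i = Fin.succ (e j), (Sum.elim x y : _ → A) i =
      Sum.elim (fun i : Fin m => x i.succ) (fun i : Fin n => y i.succ) j := by
    intro j
    rw [Finset.prod_filter, Fintype.prod_sum_type, Fin.prod_univ_succ, Fin.prod_univ_succ]
    rcases j with j | j <;> simp [hl', hr', hl0, hr0, (Fin.succ_ne_zero _).symm]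
  rw [term, proj_incl_self]
  change coeff f w (PiTensorProduct.tprod C fun j => ∏ i with H i = j, Sum.elim x y i) = _
  rw [coeff_tprod, coeff_tprod, coeff_tprod, h0, ← Equiv.prod_comp e, Fintype.prod_sum_type]
  simp only [h1, map_mul, Sum.elim_inl, Sum.elim_inr, Function.comp]
  ring

/-- By bilinearity pure tensors suffice. The projection removes the terms of lower degree, and those
that survive carry the zeroth power of the weight. -/
theorem coeff_proj_incl_mul_incl {K B : Type*} [CommRing K] [Algebra A K] [Algebra C K]
    [IsScalarTower C A K] (f : B → A →ₗ[C] K) {m n : ℕ}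
    {e : TopShuffle m n → Fin m ⊕ Fin n ≃ Fin (m + n)}
    (hl : ∀ s i, (s.1.1.2 (Sum.inl i.succ) : ℕ) = e s (Sum.inl i) + 1)
    (hr : ∀ s i, (s.1.1.2 (Sum.inr i.succ) : ℕ) = e s (Sum.inr i) + 1)
    (w : Fin (m + n) → B) (x : ⨂[C]^(m + 1) A) (y : ⨂[C]^(n + 1) A) :
    coeff f w (proj (m + n) (incl wt m x * incl wt n y)) =
      ∑ s, coeff f (w ∘ e s ∘ Sum.inl) x * coeff f (w ∘ e s ∘ Sum.inr) y := by
  classical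
  induction x using PiTensorProduct.induction_on with
  | add x x' hx hx' => simp only [map_add, add_mul, hx, hx', Finset.sum_add_distrib]
  | smul_tprod r x =>
  induction y using PiTensorProduct.induction_on with
  | add y y' hy hy' => simp only [map_add, mul_add, hy, hy', Finset.sum_add_distrib]
  | smul_tprod q y =>
  have h : coeff f w (proj (m + n) (incl wt m (PiTensorProduct.tprod C x) *
      incl wt n (PiTensorProduct.tprod C y))) =
      ∑ s, coeff f (w ∘ e s ∘ Sum.inl) (PiTensorProduct.tprod C x) *
        coeff f (w ∘ e s ∘ Sum.inr) (PiTensorProduct.tprod C y) := by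
    rw [incl_mul_incl_eq_sum]
    simp only [map_sum, map_smul]
    rw [← Finset.sum_filter_of_ne (p := fun p : {p // IsQuasiShuffle m n p} => p.1.1 = m + n)
      fun p _ hp => by_contra fun h => hp <| by
        rw [term, proj_incl_of_ne h, map_zero, smul_zero],
      ← Finset.sum_subtype_eq_sum_filter, Finset.subtype_univ]
    refine Finset.sum_congr rfl fun s _ => ?_
    rw [s.2, Nat.sub_self, pow_zero, one_smul, coeff_proj_term f w s (e s) (hl s) (hr s)]
  simp only [map_smul, smul_mul', mul_comm' _ (q • _)]
  simp only [map_smul, smul_mul', mul_comm' (incl wt n _), h, Finset.smul_sum, smul_mul_assoc,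
    mul_smul_comm]

end ShuffleBaxterAlgebra

/-! ### The domain property against torsion-freeness. -/

namespace ShuffleBaxterAlgebra

open ShuffleBaxter

variable {C A : Type*} [CommRing C] [CommRing A] [Algebra C A] {wt : C}

variable (C wt) in
/-- The inclusion of `A` as the summand `A^{⊗1}`. -/
noncomputable def inclBase : A →ₗ[C] ShuffleBaxterAlgebra C A wt :=
  incl wt 0 ∘ₗ (PiTensorProduct.subsingletonEquiv (R := C) (s := fun _ => A)
    (0 : Fin 1)).symm.toLinearMap

theorem inclBase_apply (a : A) :
    inclBase C wt a = incl wt 0 (PiTensorProduct.tprod C fun _ => a) :=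
  congrArg (incl wt 0) (PiTensorProduct.subsingletonEquiv_symm_apply' (0 : Fin 1) a)

theorem inclBase_injective : Function.Injective (inclBase (A := A) C wt) :=
  (incl_injective 0).comp (LinearEquiv.injective _)

theorem inclBase_one : inclBase C wt (1 : A) = 1 := inclBase_apply 1

theorem inclBase_mul (a b : A) : inclBase C wt (a * b) = inclBase C wt a * inclBase C wt b := by
  simp only [inclBase_apply]
  rw [incl_mul_incl_eq_sum, Fintype.sum_eq_single ⟨_, isQuasiShuffle_zero 0⟩
    fun p hp => absurd (eq_isQuasiShuffle_zero p) hp]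
  change _ = wt ^ (0 + 0 - 0) • incl wt 0 (PiTensorProduct.tprod C _)
  rw [pow_zero, one_smul]
  congr 2
  funext j
  obtain rfl : j = 0 := Fin.fin_one_eq_zero j
  rw [Finset.prod_filter, Fintype.prod_sum_type]
  simp

theorem isDomain_base [IsDomain (ShuffleBaxterAlgebra C A wt)] : IsDomain A := by
  have : Nontrivial A := ⟨0, 1, fun h => zero_ne_one (α := ShuffleBaxterAlgebra C A wt) <| by
    rw [← inclBase_one, ← h, map_zero]⟩
  have : NoZeroDivisors A :=
    inclBase_injective.noZeroDivisors (inclBase C wt) (map_zero _) inclBase_mul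
  exact NoZeroDivisors.to_isDomain A

/-- Scaling by `r` is multiplication by the image of `r` in the summand `A^{⊗1}`, which is non-zero
in a domain. -/
theorem eq_zero_of_smul_eq_zero [IsDomain (ShuffleBaxterAlgebra C A wt)] {r : C}
    (hr : algebraMap C A r ≠ 0) {k : ℕ} {x : ⨂[C]^(k + 1) A} (h : r • x = 0) : x = 0 := by
  have h1 : inclBase C wt (algebraMap C A r) * incl wt k x = 0 := by
    rw [Algebra.algebraMap_eq_smul_one, map_smul, smul_mul', inclBase_one, one_mul, ← map_smul, h,
      map_zero]
  rcases mul_eq_zero.1 h1 with h1 | h1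
  · exact absurd (inclBase_injective (h1.trans (map_zero _).symm)) hr
  · exact incl_injective k (h1.trans (map_zero _).symm)

theorem isDomain_of_torsionFree [CharZero A] [IsDomain A]
    (htf : ∀ (k : ℕ) (r : C), algebraMap C A r ≠ 0 → ∀ x : ⨂[C]^(k + 1) A, r • x = 0 → x = 0) :
    IsDomain (ShuffleBaxterAlgebra C A wt) := by
  have : Nontrivial (ShuffleBaxterAlgebra C A wt) :=
    (inclBase_injective (C := C) (A := A) (wt := wt)).nontrivial
  have : NoZeroDivisors (ShuffleBaxterAlgebra C A wt) := by
    refine ⟨fun {X Y} hXY => ?_⟩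
    by_contra! h
    obtain ⟨m, hm, hX⟩ := exists_proj_ne_zero h.1
    obtain ⟨n, hn, hY⟩ := exists_proj_ne_zero h.2
    -- Among the products of components of `X` and `Y`, only that of the two top ones reaches degree
    -- `m + n`.
    have htop : proj (m + n) (incl wt m (proj m X) * incl wt n (proj n Y)) = 0 := by
      have h0 : proj (m + n) (X * Y) = 0 := by rw [hXY, map_zero]
      rw [hX, hY, Finset.sum_mul, map_sum, Finset.sum_eq_single_of_mem m (by simp),
        Finset.mul_sum, map_sum, Finset.sum_eq_single_of_mem n (by simp)] at h0
      · simpa only [map_sum, ← hX, ← hY] using h0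
      · intro l hl hln
        rw [Finset.mem_range] at hl
        exact proj_incl_mul_incl_of_lt (by omega) _ _
      · intro k hk hkm
        rw [Finset.mul_sum, map_sum]
        refine Finset.sum_eq_zero fun l hl => ?_
        rw [Finset.mem_range] at hk hl
        exact proj_incl_mul_incl_of_lt (by omega) _ _
    have hchar : CharZero (FractionRing A) :=
      charZero_of_injective_algebraMap (IsFractionRing.injective A (FractionRing A))
    obtain ⟨B, b, f, h1, h0, hb⟩ := exists_dualFamily C A (FractionRing A)
    -- Any linear order on the letters serves: the maxima are taken over finite sets of words.
    let _ : LinearOrder B := IsWellOrder.linearOrder WellOrderingRel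
    choose e hel her hl hr using fun s : TopShuffle m n => s.exists_equiv
    have hS : ∀ r ∈ nonzeroScalars C A, ∀ x : FractionRing A, r • x = 0 → x = 0 := by
      intro r hr x hx
      rw [Algebra.smul_def, IsScalarTower.algebraMap_apply C A (FractionRing A)] at hx
      refine (mul_eq_zero.1 hx).resolve_left fun h => mem_nonzeroScalars.1 hr ?_
      exact IsFractionRing.injective A (FractionRing A) (h.trans (map_zero _).symm)
    obtain ⟨w, hw⟩ := exists_sum_shuffle_ne_zero hel her (finite_coeff_ne_zero h1 h0 hb hS _)
      (finite_coeff_ne_zero h1 h0 hb hS _)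
      (exists_coeff_ne_zero h1 h0 hb (IsFractionRing.injective A _)
        (fun r hr => htf m r (mem_nonzeroScalars.1 hr)) hm)
      (exists_coeff_ne_zero h1 h0 hb (IsFractionRing.injective A _)
        (fun r hr => htf n r (mem_nonzeroScalars.1 hr)) hn)
    rw [← coeff_proj_incl_mul_incl f hl hr w, htop, map_zero] at hw
    exact hw rfl
  exact NoZeroDivisors.to_isDomain _

end ShuffleBaxterAlgebra

/-! ### Torsion over the quotient and base change to its fraction field. -/

theorem mem_quotientTorsion {C : Type*} [CommRing C] {I : Ideal C} {N : Type*} [AddCommGroup N]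
    [Module C N] {x : N} : x ∈ quotientTorsion I N ↔ ∃ r ∉ I, r • x = 0 := by
  simp only [quotientTorsion, Set.mem_ofPred_eq, ne_eq, Ideal.Quotient.eq_zero_iff_mem]

theorem quotientTorsion_eq_singleton_zero_iff {C : Type*} [CommRing C] {I : Ideal C} (hI : I ≠ ⊤)
    {N : Type*} [AddCommGroup N] [Module C N] :
    quotientTorsion I N = {0} ↔ ∀ r ∉ I, ∀ x : N, r • x = 0 → x = 0 := by
  constructor
  · intro h r hr x hx
    exact h.le (mem_quotientTorsion.2 ⟨r, hr, hx⟩)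
  · intro h
    refine Set.eq_singleton_iff_unique_mem.2 ⟨?_, fun x hx => ?_⟩
    -- Properness of `I` makes `1` a valid witness that zero is torsion.
    · exact mem_quotientTorsion.2 ⟨1, (Ideal.ne_top_iff_one I).1 hI, smul_zero _⟩
    · obtain ⟨r, hr, hx⟩ := mem_quotientTorsion.1 hx
      exact h r hr x hx

/-- A module over `C` annihilated by a prime ideal `I` injects into its base change to the fraction
field of `C ⧸ I` if and only if it has no `C ⧸ I`-torsion. -/
theorem injective_mk_fractionRing_iff {C : Type*} [CommRing C] {I : Ideal C} [I.IsPrime]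
    {N : Type*} [AddCommGroup N] [Module C N] (hN : Module.IsTorsionBySet C N I) :
    Function.Injective (TensorProduct.mk C (FractionRing (C ⧸ I)) N 1) ↔
      ∀ r ∉ I, ∀ x : N, r • x = 0 → x = 0 := by
  constructor
  · intro hinj r hr x hx
    apply hinj
    have hr' : algebraMap C (FractionRing (C ⧸ I)) r ≠ 0 := by
      rw [IsScalarTower.algebraMap_apply C (C ⧸ I), Ideal.Quotient.algebraMap_eq]
      intro h
      exact hr (Ideal.Quotient.eq_zero_iff_mem.1
        (IsFractionRing.injective (C ⧸ I) (FractionRing (C ⧸ I)) (h.trans (map_zero _).symm)))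
    -- Since `r` is invertible in the fraction field, it can be extracted from `1` and moved across
    -- the tensor sign onto `x`.
    have h1 : (1 : FractionRing (C ⧸ I)) = r • (algebraMap C (FractionRing (C ⧸ I)) r)⁻¹ := by
      rw [Algebra.smul_def, mul_inv_cancel₀ hr']
    rw [map_zero, TensorProduct.mk_apply, h1, TensorProduct.smul_tmul, hx, TensorProduct.tmul_zero]
  · intro h
    let _ : Module (C ⧸ I) N := hN.module
    have _ : IsScalarTower C (C ⧸ I) N := hN.isScalarTower
    let F := FractionRing (C ⧸ I)
    let g := TensorProduct.mk (C ⧸ I) F N 1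
    have hg : IsLocalizedModule (nonZeroDivisors (C ⧸ I)) g :=
      (isLocalizedModule_iff_isBaseChange _ F g).2 (TensorProduct.isBaseChange (C ⧸ I) N F)
    have hg' : Function.Injective g := by
      rw [injective_iff_map_eq_zero]
      intro x hx
      obtain ⟨⟨r, hr⟩, hrx⟩ := (IsLocalizedModule.eq_zero_iff (nonZeroDivisors (C ⧸ I)) g).1 hx
      obtain ⟨r, rfl⟩ := Ideal.Quotient.mk_surjective r
      refine h r (fun hrI => ?_) x hrx
      exact nonZeroDivisors.ne_zero hr (Ideal.Quotient.eq_zero_iff_mem.2 hrI)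
    -- The localization map `g` over `C ⧸ I` factors through the tensor product over `C` by way of
    -- `φ`, so injectivity of `g` suffices.
    let φ : F ⊗[C] N →ₗ[C] F ⊗[C ⧸ I] N :=
      TensorProduct.lift ((TensorProduct.mk (C ⧸ I) F N).restrictScalars₁₂ C C)
    exact Function.Injective.of_comp (f := φ) hg'

/-- A scalar can be absorbed into the first entry of a pure tensor, which exists because `1 ≤ n`;
the power with `n = 0` is `C` itself. -/
theorem isTorsionBySet_tensorPower {C A : Type*} [CommRing C] [CommRing A] [Algebra C A] {n : ℕ}
    (hn : 1 ≤ n) : Module.IsTorsionBySet C (⨂[C]^n A) (RingHom.ker (algebraMap C A)) := by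
  rintro x ⟨r, hr⟩
  change r • x = 0
  have hr : algebraMap C A r = 0 := hr
  induction x using PiTensorProduct.induction_on with
  | add x y hx hy => rw [smul_add, hx, hy, add_zero]
  | smul_tprod q x =>
    have h := (PiTensorProduct.tprod C).map_update_smul x ⟨0, hn⟩ r (x ⟨0, hn⟩)
    rw [Function.update_eq_self, Algebra.smul_def, hr, zero_mul,
      MultilinearMap.map_update_zero] at h
    rw [smul_comm, ← h, smul_zero]

theorem mainTheorem1 {C A : Type*} [CommRing C] [CommRing A] [Algebra C A] [CharZero A] (wt : C) :
    List.TFAE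
      [IsDomain (ShuffleBaxterAlgebra C A wt),
       IsDomain A ∧ ∀ n : ℕ, 1 ≤ n →
         quotientTorsion (RingHom.ker (algebraMap C A)) (⨂[C]^n A) = {0},
       IsDomain A ∧ ∀ n : ℕ, 1 ≤ n → Function.Injective
         (TensorProduct.mk C (FractionRing (C ⧸ RingHom.ker (algebraMap C A))) (⨂[C]^n A) 1)] := by
  have hker : ∀ r, r ∉ RingHom.ker (algebraMap C A) ↔ algebraMap C A r ≠ 0 := fun r => by
    rw [RingHom.mem_ker]
  tfae_have 1 → 2 := by
    intro _
    have : IsDomain A := ShuffleBaxterAlgebra.isDomain_base (C := C) (wt := wt)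
    refine ⟨this, fun n hn => ?_⟩
    obtain ⟨k, rfl⟩ := Nat.exists_eq_add_of_le' hn
    exact (quotientTorsion_eq_singleton_zero_iff (RingHom.ker_ne_top _)).2 fun r hr x hx =>
      ShuffleBaxterAlgebra.eq_zero_of_smul_eq_zero (wt := wt) ((hker r).1 hr) hx
  tfae_have 2 → 1 := by
    rintro ⟨_, h⟩
    exact ShuffleBaxterAlgebra.isDomain_of_torsionFree fun k r hr =>
      (quotientTorsion_eq_singleton_zero_iff (RingHom.ker_ne_top _)).1 (h (k + 1) (by omega)) r
        ((hker r).2 hr)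
  tfae_have 2 ↔ 3 := by
    refine and_congr_right fun _ => forall₂_congr fun n hn => ?_
    -- The kernel is prime because `A` is a domain, so the fraction ring of the quotient is a field.
    have := RingHom.ker_isPrime (algebraMap C A)
    rw [quotientTorsion_eq_singleton_zero_iff (RingHom.ker_ne_top _),
      injective_mk_fractionRing_iff (isTorsionBySet_tensorPower hn)]
  tfae_finish
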